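/- Let $d\in\mathbb N$ and write $L^2=L^2(\mathbb R^d)$, with real- or complex-valued functions. *The operator.* Let $V\in L^1_{\rm loc}(\mathbb R^d)$ be real valued. For $\psi\in L^2$ put $E[\psi]=\int_{\mathbb R^d}(|\nabla\psi|^2+V|\psi|^2)\,dx$ if $\psi\in H^1(\mathbb R^d)$ and $V|\psi|^2\in L^1(\mathbb R^d)$, and $E[\psi]=+\infty$ otherwise. Let $H_V=-\Delta+V$ be the operator associated with this form: $H_V\psi=f$ means that $E[\psi]<\infty$, $f\in L^2$ and $\int(\nabla\bar\varphi\cdot\nabla\psi+V\bar\varphi\psi)\,dx=\langle\varphi,f\rangle$ for all $\varphi$ with $E[\varphi]<\infty$. For $i\ge1$ let $\lambda_i=\inf_{F\subset L^2,\ \dim F=i}\ \sup_{\psi\in F,\ \|\psi\|=1}E[\psi]$. *The entropy function.* Let $D\subset[0,\infty)$ be an interval containing $0$, and let $\beta:D\to\mathbb R$ be strictly convex (set $\beta=+\infty$ off $D$), with $\beta(0)=0$ and $\beta\in C^1$ on the interior of $D$. For real $s$, $(\beta')^{-1}(s)$ denotes the interior point $\nu$ of $D$ with $\beta'(\nu)=s$,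 or $0$ if $s\le\inf_{t\in D,\,t>0}\beta(t)/t$ (the right slope of $\beta$ at $0$). *Assumption (H).* All $\lambda_i$ are finite, they form an unbounded sequence of eigenvalues of $H_V$ in which each one is repeated according to its multiplicity, $\bar\nu_i:=(\beta')^{-1}(-\lambda_i)$ exists for all $i\ge1$, and the series $\sum_i\beta(\bar\nu_i)$ and $\sum_i\bar\nu_i\lambda_i$ converge. Let $S$ be the set of nonincreasing sequences $\nu=(\nu_i)_{i\ge1}$ in $D$ that converge to $0$ and for which $\sum_i\beta(\nu_i)$ converges absolutely. For $\nu\in S$ and $\psi=(\psi_i)_{i\ge1}$ in $L^2$ let $$\mathcal F[\nu,\psi]=\sum_{i}\beta(\nu_i)+\sum_{i}\nu_i\,E[\psi_i]$$ (with $0\cdot\infty=0$). A *minimizer* is a pair $(\nu,\psi)$ that minimizes $\mathcal F$ among all pairs with $\nu\in S$ and $\psi$ orthonormal in $L^2$. **Proposition.** Assume (H). Then: 1. There is an orthonormal sequence $\bar\psi=(\bar\psi_i)_{i\ge1}$ with $H_V\bar\psi_i=\lambda_i\bar\psi_i$ for all $i$, and it can be chosen real valued. 2. For every orthonormal sequence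 $\bar\psi$ with $H_V\bar\psi_i=\lambda_i\bar\psi_i$ for all $i$, the pair $(\bar\nu,\bar\psi)$ is a minimizer; the series $\sum_i\beta(\bar\nu_i)$ and $\sum_i\bar\nu_i\lambda_i$ converge absolutely, and $\mathcal F[\bar\nu,\bar\psi]=\sum_i\beta(\bar\nu_i)+\sum_i\bar\nu_i\lambda_i$. 3. Every minimizer $(\nu,\psi)$ has $\nu_i=\bar\nu_i=(\beta')^{-1}(-\lambda_i)$ for all $i$. 4. If $\bar\nu_i>0$ for all $i$, then every minimizer $(\bar\nu,\psi)$ satisfies $H_V\psi_i=\lambda_i\psi_i$ for all $i$, and $\psi$ is unique up to unitary maps preserving the eigenspaces: given a minimizer $(\bar\nu,\psi)$, a pair $(\bar\nu,\psi')$ is a minimizer if and only if there is a unitary map $U$ of $L^2$ that maps every eigenspace of $H_V$ onto itself, with $\psi_i'=U\psi_i$ for all $i$. 5. If $(\nu,\psi)$ is a minimizer and $|c_i|=1$ for all $i$, then $(\nu,(c_i\psi_i)_i)$ is a minimizer. -/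

import Mathlib

open MeasureTheory Filter Topology
open scoped ENNReal ContDiff

noncomputable section

namespace FreeEnergy

/-- The space `L²(ℝᵈ)` of `𝕜`-valued functions, `𝕜 = ℝ` or `ℂ`, for the Lebesgue measure. -/
abbrev L2 (d : ℕ) (𝕜 : Type) [RCLike 𝕜] : Type :=
  Lp 𝕜 2 (volume : Measure (EuclideanSpace ℝ (Fin d)))

section Form

variable {d : ℕ} {𝕜 : Type} [RCLike 𝕜]

/-- `g` is the weak partial derivative `∂ψ/∂xⱼ`: integration by parts holds against all
real test functions. -/
def IsWeakPartial (j : Fin d) (ψ g : L2 d 𝕜) : Prop :=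
  ∀ φ : EuclideanSpace ℝ (Fin d) → ℝ, ContDiff ℝ ∞ φ → HasCompactSupport φ →
    ∫ x, (fderiv ℝ φ x (EuclideanSpace.single j 1)) • ψ x = - ∫ x, φ x • g x

open Classical in
/-- The weak partial derivative `∂ψ/∂xⱼ ∈ L²` when it exists (it is then unique), `0` otherwise. -/
def weakPartial (j : Fin d) (ψ : L2 d 𝕜) : L2 d 𝕜 :=
  if h : ∃ g : L2 d 𝕜, IsWeakPartial j ψ g then h.choose else 0

theorem integrable_smul_L2 {φ : EuclideanSpace ℝ (Fin d) → ℝ} (hφ : Continuous φ)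
    (hc : HasCompactSupport φ) (ψ : L2 d 𝕜) : Integrable (fun x => φ x • ψ x) :=
  ((Lp.memLp ψ).locallyIntegrable (by norm_num)).integrable_smul_left_of_hasCompactSupport hφ hc

theorem integrable_deriv_smul_L2 {φ : EuclideanSpace ℝ (Fin d) → ℝ} (hφ : ContDiff ℝ ∞ φ)
    (hc : HasCompactSupport φ) (j : Fin d) (ψ : L2 d 𝕜) :
    Integrable (fun x => (fderiv ℝ φ x (EuclideanSpace.single j 1)) • ψ x) :=
  integrable_smul_L2 ((hφ.continuous_fderiv (by simp)).clm_apply continuous_const)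
    (hc.fderiv_apply (𝕜 := ℝ) _) ψ

theorem IsWeakPartial.unique {j : Fin d} {ψ g g' : L2 d 𝕜} (h : IsWeakPartial j ψ g)
    (h' : IsWeakPartial j ψ g') : g = g' := by
  apply Lp.ext
  refine ae_eq_of_integral_contDiff_smul_eq ((Lp.memLp g).locallyIntegrable (by norm_num))
    ((Lp.memLp g').locallyIntegrable (by norm_num)) ?_
  intro φ hφ hc
  have := (h φ hφ hc).symm.trans (h' φ hφ hc)
  exact neg_injective this

theorem IsWeakPartial.weakPartial_eq {j : Fin d} {ψ g : L2 d 𝕜} (h : IsWeakPartial j ψ g) :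
    weakPartial j ψ = g := by
  have hex : ∃ g : L2 d 𝕜, IsWeakPartial j ψ g := ⟨g, h⟩
  rw [weakPartial, dif_pos hex]
  exact hex.choose_spec.unique h

theorem isWeakPartial_weakPartial {j : Fin d} {ψ : L2 d 𝕜}
    (h : ∃ g : L2 d 𝕜, IsWeakPartial j ψ g) : IsWeakPartial j ψ (weakPartial j ψ) := by
  obtain ⟨g, hg⟩ := h
  rwa [hg.weakPartial_eq]

theorem isWeakPartial_zero (j : Fin d) : IsWeakPartial j (0 : L2 d 𝕜) 0 := by
  intro φ _ _
  simp

theorem IsWeakPartial.add {j : Fin d} {ψ g ψ' g' : L2 d 𝕜} (h : IsWeakPartial j ψ g)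
    (h' : IsWeakPartial j ψ' g') : IsWeakPartial j (ψ + ψ') (g + g') := by
  intro φ hφ hc
  have e1 : ∫ x, (fderiv ℝ φ x (EuclideanSpace.single j 1)) • (ψ + ψ') x
      = ∫ x, ((fderiv ℝ φ x (EuclideanSpace.single j 1)) • ψ x
        + (fderiv ℝ φ x (EuclideanSpace.single j 1)) • ψ' x) := by
    apply integral_congr_ae
    filter_upwards [Lp.coeFn_add ψ ψ'] with x hx
    rw [hx, Pi.add_apply, smul_add]
  have e2 : ∫ x, φ x • (g + g') x = ∫ x, (φ x • g x + φ x • g' x) := by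
    apply integral_congr_ae
    filter_upwards [Lp.coeFn_add g g'] with x hx
    rw [hx, Pi.add_apply, smul_add]
  rw [e1, e2, integral_add (integrable_deriv_smul_L2 hφ hc j ψ)
    (integrable_deriv_smul_L2 hφ hc j ψ'), integral_add (integrable_smul_L2 hφ.continuous hc g)
    (integrable_smul_L2 hφ.continuous hc g'), h φ hφ hc, h' φ hφ hc, neg_add]

theorem IsWeakPartial.smul {j : Fin d} {ψ g : L2 d 𝕜} (c : 𝕜) (h : IsWeakPartial j ψ g) :
    IsWeakPartial j (c • ψ) (c • g) := by
  intro φ hφ hc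
  have e1 : ∫ x, (fderiv ℝ φ x (EuclideanSpace.single j 1)) • (c • ψ) x
      = ∫ x, c • ((fderiv ℝ φ x (EuclideanSpace.single j 1)) • ψ x) := by
    apply integral_congr_ae
    filter_upwards [Lp.coeFn_smul c ψ] with x hx
    rw [hx, Pi.smul_apply, smul_comm]
  have e2 : ∫ x, φ x • (c • g) x = ∫ x, c • (φ x • g x) := by
    apply integral_congr_ae
    filter_upwards [Lp.coeFn_smul c g] with x hx
    rw [hx, Pi.smul_apply, smul_comm]
  rw [e1, e2, integral_smul, integral_smul, h φ hφ hc, smul_neg]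

/-- `ψ` has finite energy: `ψ ∈ H¹(ℝᵈ)` and `∫ |V| |ψ|² < ∞`. -/
def HasFiniteEnergy (V : EuclideanSpace ℝ (Fin d) → ℝ) (ψ : L2 d 𝕜) : Prop :=
  (∀ j : Fin d, ∃ g : L2 d 𝕜, IsWeakPartial j ψ g) ∧ Integrable (fun x => V x * ‖ψ x‖ ^ 2)

theorem integrable_potential_inner {V : EuclideanSpace ℝ (Fin d) → ℝ} {φ ψ : L2 d 𝕜}
    (hφ : Integrable (fun x => V x * ‖φ x‖ ^ 2)) (hψ : Integrable (fun x => V x * ‖ψ x‖ ^ 2)) :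
    Integrable (fun x => (V x : 𝕜) * inner 𝕜 (φ x) (ψ x)) := by
  have mφ : AEStronglyMeasurable φ volume := Lp.aestronglyMeasurable φ
  have mψ : AEStronglyMeasurable ψ volume := Lp.aestronglyMeasurable ψ
  have hm : AEStronglyMeasurable (fun x => (V x : 𝕜) * inner 𝕜 (φ x) (ψ x)) volume := by
    have h1 : AEStronglyMeasurable
        (fun x => ((V x * ‖φ x‖ ^ 2 / ‖φ x‖ ^ 2 : ℝ) : 𝕜) * inner 𝕜 (φ x) (ψ x)) volume := by
      refine AEStronglyMeasurable.mul ?_ (mφ.inner mψ)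
      refine RCLike.continuous_ofReal.comp_aestronglyMeasurable ?_
      exact (hφ.aestronglyMeasurable.aemeasurable.div
        (mφ.norm.aemeasurable.pow_const 2)).aestronglyMeasurable
    refine h1.congr (Eventually.of_forall fun x => ?_)
    by_cases hx : φ x = 0
    · simp [hx]
    · have : ‖φ x‖ ^ 2 ≠ 0 := by simpa using hx
      simp only [mul_div_assoc, div_self this, mul_one]
  refine (hφ.norm.add hψ.norm).mono' hm (Eventually.of_forall fun x => ?_)
  have h1 : ‖inner 𝕜 (φ x) (ψ x)‖ ≤ ‖φ x‖ * ‖ψ x‖ := norm_inner_le_norm _ _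
  have h2 : ‖inner 𝕜 (φ x) (ψ x)‖ ≤ ‖φ x‖ ^ 2 + ‖ψ x‖ ^ 2 := by
    nlinarith [sq_nonneg (‖φ x‖ - ‖ψ x‖), sq_nonneg ‖φ x‖, sq_nonneg ‖ψ x‖]
  have h3 := mul_le_mul_of_nonneg_left h2 (abs_nonneg (V x))
  simpa [norm_mul, abs_mul, mul_add] using h3

theorem HasFiniteEnergy.zero (V : EuclideanSpace ℝ (Fin d) → ℝ) :
    HasFiniteEnergy V (0 : L2 d 𝕜) := by
  refine ⟨fun j => ⟨0, isWeakPartial_zero j⟩, ?_⟩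
  simp

theorem HasFiniteEnergy.add {V : EuclideanSpace ℝ (Fin d) → ℝ} {φ ψ : L2 d 𝕜}
    (hφ : HasFiniteEnergy V φ) (hψ : HasFiniteEnergy V ψ) : HasFiniteEnergy V (φ + ψ) := by
  refine ⟨fun j => ?_, ?_⟩
  · obtain ⟨g, hg⟩ := hφ.1 j
    obtain ⟨g', hg'⟩ := hψ.1 j
    exact ⟨g + g', hg.add hg'⟩
  · have h := (hφ.2.add ((integrable_potential_inner hφ.2 hψ.2).re.const_mul 2)).add hψ.2
    refine h.congr ?_
    filter_upwards [Lp.coeFn_add φ ψ] with x hx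
    simp only [hx, Pi.add_apply, norm_add_sq (𝕜 := 𝕜), RCLike.re_ofReal_mul]
    ring

theorem HasFiniteEnergy.smul {V : EuclideanSpace ℝ (Fin d) → ℝ} {ψ : L2 d 𝕜} (c : 𝕜)
    (hψ : HasFiniteEnergy V ψ) : HasFiniteEnergy V (c • ψ) := by
  refine ⟨fun j => ?_, ?_⟩
  · obtain ⟨g, hg⟩ := hψ.1 j
    exact ⟨c • g, hg.smul c⟩
  · refine (hψ.2.const_mul (‖c‖ ^ 2)).congr ?_
    filter_upwards [Lp.coeFn_smul c ψ] with x hx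
    rw [hx, Pi.smul_apply, norm_smul]
    ring

open Classical in
/-- The energy `E[ψ] = ∫ (|∇ψ|² + V |ψ|²)`, with the value `+∞` off its natural domain. -/
def energy (V : EuclideanSpace ℝ (Fin d) → ℝ) (ψ : L2 d 𝕜) : EReal :=
  if HasFiniteEnergy V ψ then
    ((∫ x, ((∑ j : Fin d, ‖weakPartial j ψ x‖ ^ 2) + V x * ‖ψ x‖ ^ 2) : ℝ) : EReal)
  else ⊤

/-- The sesquilinear form `∫ (∇φ̄ · ∇ψ + V φ̄ ψ)` of the energy. -/
def energyForm (V : EuclideanSpace ℝ (Fin d) → ℝ) (φ ψ : L2 d 𝕜) : 𝕜 :=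
  (∑ j : Fin d, inner 𝕜 (weakPartial j φ) (weakPartial j ψ))
    + ∫ x, (V x : 𝕜) * inner 𝕜 (φ x) (ψ x)

/-- `H_V ψ = f`, where `H_V = -Δ + V` is the operator on `L²` associated with the energy form. -/
def SchrodingerEq (V : EuclideanSpace ℝ (Fin d) → ℝ) (ψ f : L2 d 𝕜) : Prop :=
  HasFiniteEnergy V ψ ∧
    ∀ φ : L2 d 𝕜, HasFiniteEnergy V φ → energyForm V φ ψ = inner 𝕜 φ f

theorem SchrodingerEq.zero (V : EuclideanSpace ℝ (Fin d) → ℝ) :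
    SchrodingerEq V (0 : L2 d 𝕜) 0 := by
  refine ⟨HasFiniteEnergy.zero V, fun φ _ => ?_⟩
  simp [energyForm, (isWeakPartial_zero _).weakPartial_eq]

theorem SchrodingerEq.add {V : EuclideanSpace ℝ (Fin d) → ℝ} {ψ f ψ' f' : L2 d 𝕜}
    (h : SchrodingerEq V ψ f) (h' : SchrodingerEq V ψ' f') :
    SchrodingerEq V (ψ + ψ') (f + f') := by
  refine ⟨h.1.add h'.1, fun φ hφ => ?_⟩
  have hw : ∀ j, weakPartial j (ψ + ψ') = weakPartial j ψ + weakPartial j ψ' := fun j =>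
    ((isWeakPartial_weakPartial (h.1.1 j)).add
      (isWeakPartial_weakPartial (h'.1.1 j))).weakPartial_eq
  have hi : ∫ x, (V x : 𝕜) * inner 𝕜 (φ x) ((ψ + ψ') x)
      = (∫ x, (V x : 𝕜) * inner 𝕜 (φ x) (ψ x)) + ∫ x, (V x : 𝕜) * inner 𝕜 (φ x) (ψ' x) := by
    rw [← integral_add (integrable_potential_inner hφ.2 h.1.2)
      (integrable_potential_inner hφ.2 h'.1.2)]
    apply integral_congr_ae
    filter_upwards [Lp.coeFn_add ψ ψ'] with x hx
    rw [hx, Pi.add_apply, inner_add_right, mul_add]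
  rw [inner_add_right, ← h.2 φ hφ, ← h'.2 φ hφ]
  simp only [energyForm, hw, hi, inner_add_right, Finset.sum_add_distrib]
  ring

theorem SchrodingerEq.smul {V : EuclideanSpace ℝ (Fin d) → ℝ} {ψ f : L2 d 𝕜} (c : 𝕜)
    (h : SchrodingerEq V ψ f) : SchrodingerEq V (c • ψ) (c • f) := by
  refine ⟨h.1.smul c, fun φ hφ => ?_⟩
  have hw : ∀ j, weakPartial j (c • ψ) = c • weakPartial j ψ := fun j =>
    ((isWeakPartial_weakPartial (h.1.1 j)).smul c).weakPartial_eq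
  have hi : ∫ x, (V x : 𝕜) * inner 𝕜 (φ x) ((c • ψ) x)
      = c * ∫ x, (V x : 𝕜) * inner 𝕜 (φ x) (ψ x) := by
    rw [← integral_const_mul]
    apply integral_congr_ae
    filter_upwards [Lp.coeFn_smul c ψ] with x hx
    rw [hx, Pi.smul_apply, inner_smul_right]
    ring
  rw [inner_smul_right, ← h.2 φ hφ]
  simp only [energyForm, hw, hi, inner_smul_right, mul_add, Finset.mul_sum]

/-- The eigenspace `{ψ : H_V ψ = μ ψ}` of `H_V = -Δ + V` (it is `{0}` if `μ` is no eigenvalue). -/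
def eigenspace (𝕜 : Type) [RCLike 𝕜] (V : EuclideanSpace ℝ (Fin d) → ℝ) (μ : ℝ) :
    Submodule 𝕜 (L2 d 𝕜) where
  carrier := {ψ | SchrodingerEq V ψ ((μ : 𝕜) • ψ)}
  zero_mem' := by
    simpa using SchrodingerEq.zero (𝕜 := 𝕜) V
  add_mem' := by
    intro a b ha hb
    simpa only [Set.mem_ofPred_eq, smul_add] using SchrodingerEq.add ha hb
  smul_mem' := by
    intro c a ha
    have := SchrodingerEq.smul c ha
    simpa only [Set.mem_ofPred_eq, smul_comm c] using this

/-- The min-max value `inf_{dim F = i + 1} sup_{ψ ∈ F, ‖ψ‖ = 1} E[ψ]`; sequences are indexed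
from `0`. -/
def minMax (𝕜 : Type) [RCLike 𝕜] (V : EuclideanSpace ℝ (Fin d) → ℝ) (i : ℕ) : EReal :=
  ⨅ (F : Submodule 𝕜 (L2 d 𝕜)) (_ : Module.finrank 𝕜 F = i + 1),
    ⨆ (ψ : L2 d 𝕜) (_ : ψ ∈ F) (_ : ‖ψ‖ = 1), energy V ψ

/-- `H_V = -Δ + V` has the unbounded sequence of eigenvalues `lam`: these are the (finite) min-max
values, each of them is an eigenvalue, and eigenvalues are repeated according to multiplicity. -/
structure HasUnboundedEigenvalues (𝕜 : Type) [RCLike 𝕜] (V : EuclideanSpace ℝ (Fin d) → ℝ)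
    (lam : ℕ → ℝ) : Prop where
  eq_minMax : ∀ i, minMax 𝕜 V i = (lam i : EReal)
  multiplicity : ∀ i, Module.finrank 𝕜 (eigenspace 𝕜 V (lam i)) = Nat.card {j : ℕ // lam j = lam i}
  unbounded : ¬ BddAbove (Set.range lam)

end Form

/-- `ν = (β')⁻¹(s)` for the convex function equal to `β` on `D ⊆ [0, ∞)` and to `+∞` off `D`:
either `ν` is interior to `D` and `β'(ν) = s`, or `ν = 0` and `s` does not exceed the slope
`β'(0+) = inf_{t > 0} (β t - β 0) / t` of `β` at `0`. -/
def IsInverseDeriv (D : Set ℝ) (β : ℝ → ℝ) (s ν : ℝ) : Prop :=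
  (ν ∈ interior D ∧ deriv β ν = s) ∨ (ν = 0 ∧ ∀ t ∈ D, 0 < t → s ≤ (β t - β 0) / t)

/-- Assumption (H) on `β` (finite exactly on the interval `D ⊆ [0, ∞)`) and `V`, for the eigenvalue
sequence `lam` of `-Δ + V` and the occupation numbers `nubar i = (β')⁻¹(-lam i)`. The two series
are only required to converge in the sense of partial sums. -/
structure AssumptionH {d : ℕ} (𝕜 : Type) [RCLike 𝕜] (D : Set ℝ) (β : ℝ → ℝ)
    (V : EuclideanSpace ℝ (Fin d) → ℝ) (lam nubar : ℕ → ℝ) : Prop where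
  domain_nonneg : D ⊆ Set.Ici 0
  zero_mem : (0 : ℝ) ∈ D
  strictConvex : StrictConvexOn ℝ D β
  map_zero : β 0 = 0
  contDiff : ContDiffOn ℝ 1 β (interior D)
  locallyIntegrable : LocallyIntegrable V
  eigenvalues : HasUnboundedEigenvalues 𝕜 V lam
  inverse : ∀ i, IsInverseDeriv D β (-lam i) (nubar i)
  entropy_converges :
    ∃ a : ℝ, Tendsto (fun n => ∑ i ∈ Finset.range n, β (nubar i)) atTop (𝓝 a)
  energy_converges :
    ∃ b : ℝ, Tendsto (fun n => ∑ i ∈ Finset.range n, nubar i * lam i) atTop (𝓝 b)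

/-- The set `S` of nonincreasing sequences of nonnegative numbers (in the domain `D` of `β`)
converging to `0` for which `∑ β(νᵢ)` converges absolutely. -/
def occupationNumbers (D : Set ℝ) (β : ℝ → ℝ) : Set (ℕ → ℝ) :=
  {ν | Antitone ν ∧ (∀ i, 0 ≤ ν i ∧ ν i ∈ D) ∧ Tendsto ν atTop (𝓝 0) ∧
    Summable (fun i => |β (ν i)|)}

/-- The sum of a series in `[-∞, ∞]`: the sum of the positive parts minus that of the negative
parts. -/
def extendedSum (a : ℕ → EReal) : EReal :=
  ((∑' i, (a i).toENNReal : ℝ≥0∞) : EReal) - ((∑' i, (-a i).toENNReal : ℝ≥0∞) : EReal)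

section MixedStates

variable {d : ℕ} {𝕜 : Type} [RCLike 𝕜]

/-- The free energy `F[ν, ψ] = ∑ β(νᵢ) + ∑ νᵢ E[ψᵢ]`, for `ν ∈ S`, with values in `[-∞, ∞]`. -/
def freeEnergy (β : ℝ → ℝ) (V : EuclideanSpace ℝ (Fin d) → ℝ) (ν : ℕ → ℝ) (ψ : ℕ → L2 d 𝕜) :
    EReal :=
  ((∑' i, β (ν i) : ℝ) : EReal) + extendedSum (fun i => (ν i : EReal) * energy V (ψ i))

/-- `(ν, ψ)` minimizes the free energy over `S × (L²)^ℕ` under the orthonormality constraint. -/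
def IsMinimizer (D : Set ℝ) (β : ℝ → ℝ) (V : EuclideanSpace ℝ (Fin d) → ℝ) (ν : ℕ → ℝ)
    (ψ : ℕ → L2 d 𝕜) : Prop :=
  ν ∈ occupationNumbers D β ∧ Orthonormal 𝕜 ψ ∧
    ∀ (ν' : ℕ → ℝ) (ψ' : ℕ → L2 d 𝕜), ν' ∈ occupationNumbers D β → Orthonormal 𝕜 ψ' →
      freeEnergy β V ν ψ ≤ freeEnergy β V ν' ψ'

/-- The unitary map `U` of `L²` leaves all eigenspaces of `-Δ + V` invariant. -/
def PreservesEigenspaces (V : EuclideanSpace ℝ (Fin d) → ℝ) (U : L2 d 𝕜 ≃ₗᵢ[𝕜] L2 d 𝕜) : Prop :=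
  ∀ μ : ℝ, (eigenspace 𝕜 V μ).map (U.toLinearEquiv : L2 d 𝕜 →ₗ[𝕜] L2 d 𝕜) = eigenspace 𝕜 V μ

end MixedStates

end FreeEnergy

end

/-! Summation by parts separates the occupation numbers from the functions. Put `δ n = ∑_{j<n} (E[φ
j] - lam j)` (`excess`) and let `g i` be the excess of `β t + t * lam i` at `t = ν i` over its value
at `t = nubar i` (`entropyGap`). The `n`-th partial sum of the difference between the free energies
of `(ν, φ)` and of `nubar` with eigenfunctions is `∑_{i<n} (g i + (ν i - ν (i+1)) * δ (i+1)) + ν n *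
δ n`. Strict convexity makes `nubar i` the unique minimizer of the scalar problem, so `g i ≥ 0`
(`IsInverseDeriv.lt`). The variational principle for sums of eigenvalues gives `δ n ≥ 0`
(`HasUnboundedEigenvalues.sum_le`). As `ν` is nonincreasing, every term is nonnegative
(`AssumptionH.sum_gap_le`).

The bound on `δ` comes from min-max: adjoining to the lower eigenfunctions a function orthogonal to
them gives a trial space, hence `lower_bound` and, after splitting off components, `spectral_bound`.
Summed over an orthonormal family, this yields `sum_bound`, which keeps the defect `(lam N - lam k)
* (1 - overlap)`.

For a minimizer all terms vanish. Then `g i = 0` forces `ν = nubar`. If all `nubar i` are positive,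
`β' (nubar i) = -lam i` makes `nubar` drop strictly at each spectral gap, so `δ` vanishes there and
the defect places the eigenfunctions below the gap in the span of the corresponding `φ j`. Comparing
successive gaps isolates each eigenspace (`minimizer_mem_eigenspace`).

Uniqueness up to unitaries rests on completeness: since `lam` tends to infinity, a function
orthogonal to all eigenfunctions is orthogonal to all test functions (`eq_zero_of_inner`). Two
eigenfunction systems are thus Hilbert bases, and the map between them is the desired unitary. Real
eigenfunctions exist because complex conjugation preserves the eigenspaces. -/

namespace FreeEnergy

/-! ### Algebra of the energy form and its eigenfunctions. -/

section FormLemmas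

variable {d : ℕ} {𝕜 : Type} [RCLike 𝕜] {V : EuclideanSpace ℝ (Fin d) → ℝ}

theorem HasFiniteEnergy.weakPartial_add {φ ψ : L2 d 𝕜} (hφ : HasFiniteEnergy V φ)
    (hψ : HasFiniteEnergy V ψ) (j : Fin d) :
    weakPartial j (φ + ψ) = weakPartial j φ + weakPartial j ψ :=
  ((isWeakPartial_weakPartial (hφ.1 j)).add (isWeakPartial_weakPartial (hψ.1 j))).weakPartial_eq

theorem HasFiniteEnergy.weakPartial_smul {ψ : L2 d 𝕜} (c : 𝕜) (hψ : HasFiniteEnergy V ψ)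
    (j : Fin d) : weakPartial j (c • ψ) = c • weakPartial j ψ :=
  ((isWeakPartial_weakPartial (hψ.1 j)).smul c).weakPartial_eq

theorem energyForm_add_right {χ φ ψ : L2 d 𝕜} (hχ : HasFiniteEnergy V χ)
    (hφ : HasFiniteEnergy V φ) (hψ : HasFiniteEnergy V ψ) :
    energyForm V χ (φ + ψ) = energyForm V χ φ + energyForm V χ ψ := by
  have hi : ∫ x, (V x : 𝕜) * inner 𝕜 (χ x) ((φ + ψ) x)
      = (∫ x, (V x : 𝕜) * inner 𝕜 (χ x) (φ x)) + ∫ x, (V x : 𝕜) * inner 𝕜 (χ x) (ψ x) := by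
    rw [← integral_add (integrable_potential_inner hχ.2 hφ.2)
      (integrable_potential_inner hχ.2 hψ.2)]
    apply integral_congr_ae
    filter_upwards [Lp.coeFn_add φ ψ] with x hx
    rw [hx, Pi.add_apply, inner_add_right, mul_add]
  simp only [energyForm, hφ.weakPartial_add hψ, hi, inner_add_right, Finset.sum_add_distrib]
  ring

theorem energyForm_smul_right {χ ψ : L2 d 𝕜} (c : 𝕜) (hψ : HasFiniteEnergy V ψ) :
    energyForm V χ (c • ψ) = c * energyForm V χ ψ := by
  have hi : ∫ x, (V x : 𝕜) * inner 𝕜 (χ x) ((c • ψ) x)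
      = c * ∫ x, (V x : 𝕜) * inner 𝕜 (χ x) (ψ x) := by
    rw [← integral_const_mul]
    apply integral_congr_ae
    filter_upwards [Lp.coeFn_smul c ψ] with x hx
    rw [hx, Pi.smul_apply, inner_smul_right]
    ring
  simp only [energyForm, hψ.weakPartial_smul, hi, inner_smul_right, mul_add, Finset.mul_sum]

theorem energyForm_conj_symm (φ ψ : L2 d 𝕜) :
    (starRingEnd 𝕜) (energyForm V φ ψ) = energyForm V ψ φ := by
  simp only [energyForm, map_add, map_sum, inner_conj_symm, ← integral_conj, map_mul,
    RCLike.conj_ofReal]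

theorem energyForm_add_left {χ φ ψ : L2 d 𝕜} (hχ : HasFiniteEnergy V χ)
    (hφ : HasFiniteEnergy V φ) (hψ : HasFiniteEnergy V ψ) :
    energyForm V (φ + ψ) χ = energyForm V φ χ + energyForm V ψ χ := by
  rw [← energyForm_conj_symm, energyForm_add_right hχ hφ hψ, map_add, energyForm_conj_symm,
    energyForm_conj_symm]

theorem energyForm_smul_left {χ ψ : L2 d 𝕜} (c : 𝕜) (hψ : HasFiniteEnergy V ψ) :
    energyForm V (c • ψ) χ = (starRingEnd 𝕜) c * energyForm V ψ χ := by
  rw [← energyForm_conj_symm, energyForm_smul_right c hψ, map_mul, energyForm_conj_symm]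

/-- The functions of finite energy, as a subspace of `L²`. -/
def finiteEnergy (𝕜 : Type) [RCLike 𝕜] (V : EuclideanSpace ℝ (Fin d) → ℝ) :
    Submodule 𝕜 (L2 d 𝕜) where
  carrier := {ψ | HasFiniteEnergy V ψ}
  zero_mem' := HasFiniteEnergy.zero V
  add_mem' := fun ha hb => HasFiniteEnergy.add ha hb
  smul_mem' := fun c _ ha => HasFiniteEnergy.smul c ha

theorem mem_eigenspace {ψ : L2 d 𝕜} {μ : ℝ} :
    ψ ∈ eigenspace 𝕜 V μ ↔ SchrodingerEq V ψ ((μ : 𝕜) • ψ) := Iff.rfl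

theorem HasFiniteEnergy.sum {ι : Type*} (s : Finset ι) {f : ι → L2 d 𝕜}
    (h : ∀ i ∈ s, HasFiniteEnergy V (f i)) : HasFiniteEnergy V (∑ i ∈ s, f i) :=
  (finiteEnergy 𝕜 V).sum_mem h

theorem energyForm_zero_right (χ : L2 d 𝕜) : energyForm V χ 0 = 0 := by
  have := energyForm_smul_right (χ := χ) (0 : 𝕜) (HasFiniteEnergy.zero V)
  simpa using this

theorem energyForm_sum_right {ι : Type*} {χ : L2 d 𝕜} (hχ : HasFiniteEnergy V χ) (s : Finset ι)
    {f : ι → L2 d 𝕜} (h : ∀ i ∈ s, HasFiniteEnergy V (f i)) :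
    energyForm V χ (∑ i ∈ s, f i) = ∑ i ∈ s, energyForm V χ (f i) := by
  classical
  induction s using Finset.induction_on with
  | empty => simpa using energyForm_zero_right χ
  | insert a s ha ih =>
    have hs : ∀ i ∈ s, HasFiniteEnergy V (f i) := fun i hi => h i (Finset.mem_insert_of_mem hi)
    rw [Finset.sum_insert ha, Finset.sum_insert ha,
      energyForm_add_right hχ (h a (Finset.mem_insert_self _ _)) (HasFiniteEnergy.sum s hs), ih hs]

/-- The quadratic form `∫ (|∇ψ|² + V |ψ|²)` as a real number. -/
noncomputable def formEnergy (V : EuclideanSpace ℝ (Fin d) → ℝ) (ψ : L2 d 𝕜) : ℝ :=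
  RCLike.re (energyForm V ψ ψ)

theorem ofReal_formEnergy (ψ : L2 d 𝕜) : (formEnergy V ψ : 𝕜) = energyForm V ψ ψ :=
  RCLike.conj_eq_iff_re.mp (energyForm_conj_symm ψ ψ)

/-- The integral defining the energy splits because each squared weak derivative and the potential
term are separately integrable. This is the passage from extended real energies to the form. -/
theorem HasFiniteEnergy.energy_eq {ψ : L2 d 𝕜} (h : HasFiniteEnergy V ψ) :
    energy V ψ = (formEnergy V ψ : EReal) := by
  have hsq : ∀ g : L2 d 𝕜, Integrable (fun x => ‖g x‖ ^ 2) := fun g =>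
    (memLp_two_iff_integrable_sq_norm (Lp.aestronglyMeasurable g)).mp (Lp.memLp g)
  rw [energy, if_pos h]
  congr 1
  rw [integral_add (integrable_finsetSum _ fun j _ => hsq _) h.2,
    integral_finsetSum _ fun j _ => hsq _]
  apply RCLike.ofReal_injective (K := 𝕜)
  rw [ofReal_formEnergy, energyForm, RCLike.ofReal_add, RCLike.ofReal_sum]
  congr 1
  · refine Finset.sum_congr rfl fun j _ => ?_
    rw [L2.inner_def, ← integral_ofReal]
    refine integral_congr_ae (Eventually.of_forall fun x => ?_)
    simp [inner_self_eq_norm_sq_to_K]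
  · rw [← integral_ofReal]
    refine integral_congr_ae (Eventually.of_forall fun x => ?_)
    simp [inner_self_eq_norm_sq_to_K]

theorem energy_eq_top {ψ : L2 d 𝕜} (h : ¬ HasFiniteEnergy V ψ) : energy V ψ = ⊤ := if_neg h

theorem formEnergy_smul (c : 𝕜) {ψ : L2 d 𝕜} (h : HasFiniteEnergy V ψ) :
    formEnergy V (c • ψ) = ‖c‖ ^ 2 * formEnergy V ψ := by
  apply RCLike.ofReal_injective (K := 𝕜)
  rw [ofReal_formEnergy, energyForm_smul_right c h, energyForm_smul_left c h,
    RCLike.ofReal_mul, ofReal_formEnergy, ← mul_assoc, RCLike.mul_conj]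
  simp

theorem energy_smul_of_norm_one {c : 𝕜} (hc : ‖c‖ = 1) (ψ : L2 d 𝕜) :
    energy V (c • ψ) = energy V ψ := by
  by_cases h : HasFiniteEnergy V ψ
  · rw [(h.smul c).energy_eq, h.energy_eq, formEnergy_smul c h, hc]
    simp
  · have h' : ¬ HasFiniteEnergy V (c • ψ) := fun h' => h <| by
      have := h'.smul c⁻¹
      rwa [smul_smul, inv_mul_cancel₀ (norm_ne_zero_iff.mp (by rw [hc]; exact one_ne_zero)),
        one_smul] at this
    rw [energy_eq_top h, energy_eq_top h']

theorem energyForm_eigen_right {μ : ℝ} {φ ψ : L2 d 𝕜} (hφ : HasFiniteEnergy V φ)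
    (hψ : ψ ∈ eigenspace 𝕜 V μ) : energyForm V φ ψ = μ * inner 𝕜 φ ψ := by
  rw [(mem_eigenspace.mp hψ).2 φ hφ, inner_smul_right]

theorem energyForm_eigen_left {μ : ℝ} {φ ψ : L2 d 𝕜} (hφ : HasFiniteEnergy V φ)
    (hψ : ψ ∈ eigenspace 𝕜 V μ) : energyForm V ψ φ = μ * inner 𝕜 ψ φ := by
  rw [← energyForm_conj_symm, energyForm_eigen_right hφ hψ, map_mul, inner_conj_symm,
    RCLike.conj_ofReal]

theorem finiteEnergy_of_mem_eigenspace {μ : ℝ} {ψ : L2 d 𝕜} (hψ : ψ ∈ eigenspace 𝕜 V μ) :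
    HasFiniteEnergy V ψ := (mem_eigenspace.mp hψ).1

theorem formEnergy_eigen {μ : ℝ} {ψ : L2 d 𝕜} (hψ : ψ ∈ eigenspace 𝕜 V μ) :
    formEnergy V ψ = μ * ‖ψ‖ ^ 2 := by
  rw [formEnergy, energyForm_eigen_right (finiteEnergy_of_mem_eigenspace hψ) hψ,
    RCLike.re_ofReal_mul, inner_self_eq_norm_sq]

/-- Evaluating the form through either slot yields both `μ` and `ν` times the same inner product. -/
theorem inner_eq_zero_of_eigenspace_ne {μ ν : ℝ} (h : μ ≠ ν) {φ ψ : L2 d 𝕜}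
    (hφ : φ ∈ eigenspace 𝕜 V μ) (hψ : ψ ∈ eigenspace 𝕜 V ν) : inner 𝕜 φ ψ = 0 := by
  have h1 := energyForm_eigen_right (finiteEnergy_of_mem_eigenspace hφ) hψ
  rw [energyForm_eigen_left (finiteEnergy_of_mem_eigenspace hψ) hφ] at h1
  have h2 : ((μ : 𝕜) - ν) * inner 𝕜 φ ψ = 0 := by rw [sub_mul, h1, sub_self]
  rcases mul_eq_zero.mp h2 with h3 | h3
  · exact absurd (RCLike.ofReal_injective (sub_eq_zero.mp h3)) h
  · exact h3

/-- Removing the component along a normalized eigenfunction lowers the energy accordingly. -/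
theorem formEnergy_sub_eigen {μ : ℝ} {φ ψ : L2 d 𝕜} (hφ : HasFiniteEnergy V φ)
    (hψ : ψ ∈ eigenspace 𝕜 V μ) (h1 : ‖ψ‖ = 1) :
    formEnergy V (φ - (inner 𝕜 ψ φ : 𝕜) • ψ) = formEnergy V φ - μ * ‖(inner 𝕜 ψ φ : 𝕜)‖ ^ 2 := by
  have fψ := finiteEnergy_of_mem_eigenspace hψ
  set a : 𝕜 := inner 𝕜 ψ φ with ha
  have fa : HasFiniteEnergy V ((-a) • ψ) := fψ.smul _
  have e1 : (inner 𝕜 φ ψ : 𝕜) = (starRingEnd 𝕜) a := (inner_conj_symm _ _).symm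
  have e2 : energyForm V ψ ψ = (μ : 𝕜) := by
    rw [energyForm_eigen_right fψ hψ, inner_self_eq_norm_sq_to_K, h1]; simp
  have key : energyForm V (φ + (-a) • ψ) (φ + (-a) • ψ)
      = energyForm V φ φ - (μ : 𝕜) * ((‖a‖ : 𝕜) ^ 2) := by
    rw [energyForm_add_right (hφ.add fa) hφ fa, energyForm_add_left hφ hφ fa,
      energyForm_add_left fa hφ fa, energyForm_smul_right _ fψ, energyForm_smul_right _ fψ,
      energyForm_smul_left _ fψ, energyForm_smul_left _ fψ, e2,
      energyForm_eigen_left hφ hψ, energyForm_eigen_right hφ hψ, e1, ← ha, ← RCLike.mul_conj,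
      map_neg]
    ring
  have hs : φ - a • ψ = φ + (-a) • ψ := by rw [neg_smul, sub_eq_add_neg]
  rw [hs]
  apply RCLike.ofReal_injective (K := 𝕜)
  rw [ofReal_formEnergy, key]
  simp [ofReal_formEnergy]

end FormLemmas

/-! ### Min-max and the variational principle for sums of eigenvalues. -/

section MinMax

variable {d : ℕ} {𝕜 : Type} [RCLike 𝕜] {V : EuclideanSpace ℝ (Fin d) → ℝ} {lam : ℕ → ℝ}

/-- Positivity of `n` is what makes `F` finite-dimensional, since `finrank` defaults to `0`
otherwise; part of a basis then spans `G`. -/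
theorem exists_le_finrank_eq {K E : Type*} [DivisionRing K] [AddCommGroup E] [Module K E]
    (F : Submodule K E) {m n : ℕ} (hF : Module.finrank K F = n) (hn : 0 < n) (hmn : m ≤ n) :
    ∃ G ≤ F, Module.finrank K G = m := by
  have : FiniteDimensional K F := Module.finite_of_finrank_pos (hF ▸ hn)
  let b := Module.finBasisOfFinrankEq K F hF
  have hli : LinearIndependent K (fun i : Fin m => (b (Fin.castLE hmn i) : E)) :=
    (b.linearIndependent.map' F.subtype F.ker_subtype).comp _ (Fin.castLE_injective hmn)
  refine ⟨Submodule.span K (Set.range fun i : Fin m => (b (Fin.castLE hmn i) : E)), ?_, ?_⟩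
  · rw [Submodule.span_le]
    rintro _ ⟨i, rfl⟩
    exact (b _).2
  · rw [finrank_span_eq_card hli, Fintype.card_fin]

theorem minMax_mono : Monotone (minMax 𝕜 V) := by
  refine monotone_nat_of_le_succ fun i => ?_
  refine le_iInf₂ fun F hF => ?_
  obtain ⟨G, hG, hGr⟩ := exists_le_finrank_eq F hF (by omega) (show i + 1 ≤ i + 1 + 1 by omega)
  refine (iInf₂_le G hGr).trans ?_
  exact iSup_mono fun ψ => iSup_le fun h => le_iSup_of_le (hG h) le_rfl

theorem HasUnboundedEigenvalues.monotone (h : HasUnboundedEigenvalues 𝕜 V lam) :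
    Monotone lam := fun i j hij => by
  have := minMax_mono (𝕜 := 𝕜) (V := V) hij
  rw [h.eq_minMax, h.eq_minMax] at this
  exact_mod_cast this

theorem HasUnboundedEigenvalues.tendsto (h : HasUnboundedEigenvalues 𝕜 V lam) :
    Tendsto lam atTop atTop :=
  tendsto_atTop_atTop_of_monotone h.monotone fun b => by
    by_contra! hb
    exact h.unbounded ⟨b, by rintro _ ⟨i, rfl⟩; exact (hb i).le⟩

/-- If the form is diagonal on an orthonormal family of `n + 1` functions, its largest diagonal
entry is an upper bound for the min-max value with index `n`. -/
theorem HasUnboundedEigenvalues.le_of_diagonal (h : HasUnboundedEigenvalues 𝕜 V lam) {n : ℕ}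
    {v : Fin (n + 1) → L2 d 𝕜} (hv : Orthonormal 𝕜 v) (hf : ∀ i, HasFiniteEnergy V (v i))
    (hd : ∀ i j, i ≠ j → energyForm V (v i) (v j) = 0) {t : ℝ}
    (ht : ∀ i, formEnergy V (v i) ≤ t) : lam n ≤ t := by
  have hr : Module.finrank 𝕜 (Submodule.span 𝕜 (Set.range v)) = n + 1 := by
    rw [finrank_span_eq_card hv.linearIndependent, Fintype.card_fin]
  have key : minMax 𝕜 V n ≤ (t : EReal) := by
    refine (iInf₂_le (Submodule.span 𝕜 (Set.range v)) hr).trans (iSup_le fun ψ => iSup_le fun hψ => iSup_le fun h1 => ?_)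
    obtain ⟨c, rfl⟩ := (Submodule.mem_span_range_iff_exists_fun 𝕜).mp hψ
    have fs : ∀ i ∈ Finset.univ, HasFiniteEnergy V (c i • v i) := fun i _ => (hf i).smul _
    have fψ := HasFiniteEnergy.sum Finset.univ fs
    have hq : formEnergy V (∑ i, c i • v i) = ∑ i, ‖c i‖ ^ 2 * formEnergy V (v i) := by
      apply RCLike.ofReal_injective (K := 𝕜)
      rw [ofReal_formEnergy, energyForm_sum_right fψ _ fs, RCLike.ofReal_sum]
      refine Finset.sum_congr rfl fun i _ => ?_
      rw [energyForm_smul_right _ (hf i), ← energyForm_conj_symm, energyForm_sum_right (hf i) _ fs,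
        Finset.sum_eq_single i, energyForm_smul_right _ (hf i), map_mul, energyForm_conj_symm,
        ← mul_assoc, RCLike.mul_conj, ← ofReal_formEnergy]
      · simp
      · intro j _ hj
        rw [energyForm_smul_right _ (hf j), hd i j hj.symm, mul_zero]
      · simp
    have hn : ∑ i, ‖c i‖ ^ 2 = 1 := by
      have h3 := hv.inner_sum c c Finset.univ
      apply RCLike.ofReal_injective (K := 𝕜)
      rw [inner_self_eq_norm_sq_to_K, h1] at h3
      simpa [RCLike.conj_mul] using h3.symm
    rw [fψ.energy_eq, hq]
    refine EReal.coe_le_coe_iff.mpr ?_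
    calc ∑ i, ‖c i‖ ^ 2 * formEnergy V (v i) ≤ ∑ i, ‖c i‖ ^ 2 * t :=
          Finset.sum_le_sum fun i _ => mul_le_mul_of_nonneg_left (ht i) (sq_nonneg _)
      _ = t := by rw [← Finset.sum_mul, hn, one_mul]
  rw [h.eq_minMax] at key
  exact_mod_cast key

variable {ψ : ℕ → L2 d 𝕜}

/-- On functions orthogonal to the eigenfunctions below `lam n`, the form is bounded from below by
`lam n`. -/
theorem HasUnboundedEigenvalues.lower_bound (h : HasUnboundedEigenvalues 𝕜 V lam)
    (ho : Orthonormal 𝕜 ψ) (he : ∀ i, ψ i ∈ eigenspace 𝕜 V (lam i)) (n : ℕ) {φ : L2 d 𝕜}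
    (hφ : HasFiniteEnergy V φ) (hort : ∀ k, lam k < lam n → (inner 𝕜 (ψ k) φ : 𝕜) = 0) :
    lam n * ‖φ‖ ^ 2 ≤ formEnergy V φ := by
  classical
  wlog h1 : ‖φ‖ = 1 generalizing φ
  · by_cases h0 : φ = 0
    · subst h0
      simp [formEnergy, energyForm_zero_right]
    have hpos : ‖φ‖ ≠ 0 := norm_ne_zero_iff.mpr h0
    have := this (hφ.smul ((‖φ‖ : 𝕜)⁻¹)) (fun k hk => by rw [inner_smul_right, hort k hk, mul_zero])
      (by rw [norm_smul, norm_inv, RCLike.norm_ofReal, abs_norm, inv_mul_cancel₀ hpos])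
    rw [formEnergy_smul _ hφ, norm_smul, norm_inv, RCLike.norm_ofReal, abs_norm,
      inv_mul_cancel₀ hpos] at this
    field_simp at this
    linarith
  rw [h1, one_pow, mul_one]
  by_contra! hlt
  have hex : ∃ m, lam m = lam n := ⟨n, rfl⟩
  -- `m` is the first index of the cluster of `lam n`: orthogonality is only given to strictly lower
  -- eigenfunctions, which are those with `k < m`. Together with `φ` they span a trial space of
  -- dimension `m + 1`, the right one for `lam m = lam n`.
  set m := Nat.find hex with hm
  have hmn : lam m = lam n := Nat.find_spec hex
  have hk : ∀ k : Fin m, lam k < lam n := fun k =>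
    lt_of_le_of_ne (hmn ▸ h.monotone k.2.le) (Nat.find_min hex k.2)
  set v : Fin (m + 1) → L2 d 𝕜 := Fin.cons φ (fun k : Fin m => ψ k) with hv
  have hv0 : v 0 = φ := rfl
  have hvs : ∀ k : Fin m, v k.succ = ψ k := fun k => rfl
  have hvo : Orthonormal 𝕜 v := by
    constructor
    · intro i
      refine Fin.cases (by rw [hv0, h1]) (fun k => ?_) i
      rw [hvs, ho.1]
    · intro i j
      refine Fin.cases ?_ (fun k => ?_) i <;> refine Fin.cases ?_ (fun l => ?_) j
      · simp
      · intro _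
        rw [hv0, hvs, ← inner_conj_symm, hort l (hk l), map_zero]
      · intro _
        rw [hv0, hvs, hort k (hk k)]
      · intro hkl
        rw [hvs, hvs]
        refine ho.2 fun hne => hkl ?_
        rw [Fin.ext hne]
  have hf : ∀ i, HasFiniteEnergy V (v i) := fun i =>
    Fin.cases (motive := fun i => HasFiniteEnergy V (v i)) hφ
      (fun k => finiteEnergy_of_mem_eigenspace (he k)) i
  have hd : ∀ i j, i ≠ j → energyForm V (v i) (v j) = 0 := by
    intro i j hij
    have hz := hvo.2 hij
    revert hz hij
    refine Fin.cases ?_ (fun l => ?_) j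
    · refine Fin.cases (by simp) (fun k => ?_) i
      intro _ hz
      rw [hvs, energyForm_eigen_left (hf 0) (he k), ← hvs, hz, mul_zero]
    · intro _ hz
      rw [hvs, energyForm_eigen_right (hf i) (he l), ← hvs, hz, mul_zero]
  -- Finitely many strict inequalities have a strict maximum, which supplies the uniform bound.
  obtain ⟨t, ht, htn⟩ : ∃ t, (∀ i, formEnergy V (v i) ≤ t) ∧ t < lam n := by
    refine ⟨Finset.univ.sup' Finset.univ_nonempty fun i => formEnergy V (v i),
      fun i => Finset.le_sup' (fun i => formEnergy V (v i)) (Finset.mem_univ i), ?_⟩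
    rw [Finset.sup'_lt_iff]
    intro i _
    refine Fin.cases hlt (fun k => ?_) i
    rw [hvs, formEnergy_eigen (he k), ho.1, one_pow, mul_one]
    exact hk k
  have := h.le_of_diagonal hvo hf hd ht
  linarith

/-- The energy of `φ` dominates that of its components along the first `n` eigenfunctions, plus
`lam n` times the squared norm of the rest. -/
theorem HasUnboundedEigenvalues.spectral_bound (h : HasUnboundedEigenvalues 𝕜 V lam)
    (ho : Orthonormal 𝕜 ψ) (he : ∀ i, ψ i ∈ eigenspace 𝕜 V (lam i)) (n : ℕ) {φ : L2 d 𝕜}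
    (hφ : HasFiniteEnergy V φ) :
    ∑ k ∈ Finset.range n, lam k * ‖(inner 𝕜 (ψ k) φ : 𝕜)‖ ^ 2
      + lam n * (‖φ‖ ^ 2 - ∑ k ∈ Finset.range n, ‖(inner 𝕜 (ψ k) φ : 𝕜)‖ ^ 2)
      ≤ formEnergy V φ := by
  -- `χ` is `φ` with its first `m` eigencomponents removed one at a time; the form has no cross
  -- terms, so energy and squared norm drop by explicit amounts.
  have key : ∀ m, ∃ χ : L2 d 𝕜, HasFiniteEnergy V χ ∧
      (∀ k, (inner 𝕜 (ψ k) χ : 𝕜) = if k < m then 0 else inner 𝕜 (ψ k) φ) ∧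
      formEnergy V χ = formEnergy V φ
        - ∑ k ∈ Finset.range m, lam k * ‖(inner 𝕜 (ψ k) φ : 𝕜)‖ ^ 2 ∧
      ‖χ‖ ^ 2 = ‖φ‖ ^ 2 - ∑ k ∈ Finset.range m, ‖(inner 𝕜 (ψ k) φ : 𝕜)‖ ^ 2 := by
    intro m
    induction m with
    | zero => exact ⟨φ, hφ, by simp, by simp, by simp⟩
    | succ m ih =>
      obtain ⟨χ, h1, h2, h3, h4⟩ := ih
      have hm : (inner 𝕜 (ψ m) χ : 𝕜) = inner 𝕜 (ψ m) φ := by rw [h2, if_neg (lt_irrefl m)]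
      refine ⟨χ - (inner 𝕜 (ψ m) χ : 𝕜) • ψ m,
        (finiteEnergy 𝕜 V).sub_mem h1 ((finiteEnergy_of_mem_eigenspace (he m)).smul _), ?_, ?_, ?_⟩
      · intro k
        rw [inner_sub_right, inner_smul_right, orthonormal_iff_ite.mp ho k m]
        rcases lt_trichotomy k m with hk | hk | hk
        · rw [if_neg hk.ne, mul_zero, sub_zero, h2, if_pos hk, if_pos (by omega)]
        · subst hk
          simp
        · rw [if_neg hk.ne', mul_zero, sub_zero, h2, if_neg (by omega), if_neg (by omega)]
      · rw [formEnergy_sub_eigen h1 (he m) (ho.1 m), h3, hm, Finset.sum_range_succ]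
        ring
      · rw [Finset.sum_range_succ, ← sub_sub, ← h4, ← hm, norm_sub_sq (𝕜 := 𝕜), inner_smul_right,
          norm_smul, ho.1, mul_one, ← inner_conj_symm χ (ψ m), RCLike.mul_conj]
        have : RCLike.re ((‖(inner 𝕜 (ψ m) χ : 𝕜)‖ : 𝕜) ^ 2) = ‖(inner 𝕜 (ψ m) χ : 𝕜)‖ ^ 2 := by
          rw [← RCLike.ofReal_pow, RCLike.ofReal_re]
        rw [this]
        ring
  obtain ⟨χ, h1, h2, h3, h4⟩ := key n
  have := h.lower_bound ho he n h1 fun k hk => by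
    rw [h2, if_pos (h.monotone.reflect_lt hk)]
  rw [h3, h4] at this
  linarith

variable {ι : Type*} {φ : ι → L2 d 𝕜}

/-- The part of `ψ k` in the span of a finite family of functions. -/
noncomputable def overlap (ψ : ℕ → L2 d 𝕜) (φ : ι → L2 d 𝕜) (s : Finset ι) (k : ℕ) : ℝ :=
  ∑ j ∈ s, ‖(inner 𝕜 (ψ k) (φ j) : 𝕜)‖ ^ 2

/-- Bessel's inequality for the unit vector `ψ k` and the family `φ`. -/
theorem overlap_le_one (ho : Orthonormal 𝕜 ψ) (hφ : Orthonormal 𝕜 φ) (s : Finset ι) (k : ℕ) :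
    overlap ψ φ s k ≤ 1 := by
  have := hφ.sum_inner_products_le (ψ k) (s := s)
  rw [ho.1, one_pow] at this
  simpa only [overlap, norm_inner_symm (ψ k)] using this

/-- The variational principle for sums of eigenvalues, with an explicit defect. -/
theorem HasUnboundedEigenvalues.sum_bound (h : HasUnboundedEigenvalues 𝕜 V lam)
    (ho : Orthonormal 𝕜 ψ) (he : ∀ i, ψ i ∈ eigenspace 𝕜 V (lam i)) (hφ : Orthonormal 𝕜 φ)
    (s : Finset ι) (hf : ∀ j ∈ s, HasFiniteEnergy V (φ j)) :
    ∑ k ∈ Finset.range s.card, lam k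
      + ∑ k ∈ Finset.range s.card, (lam s.card - lam k) * (1 - overlap ψ φ s k)
      ≤ ∑ j ∈ s, formEnergy V (φ j) := by
  -- The cutoff is the number of trial functions, so that the terms `lam s.card` recombine with `1 -
  -- overlap` after exchanging the sums.
  have h1 := Finset.sum_le_sum fun j hj => h.spectral_bound ho he s.card (hf j hj)
  refine le_trans (le_of_eq ?_) h1
  simp only [hφ.1, one_pow, Finset.sum_add_distrib, mul_sub, ← Finset.mul_sum,
    Finset.sum_sub_distrib, mul_one, Finset.sum_const, nsmul_eq_mul, Finset.card_range]
  rw [Finset.sum_comm (s := s), Finset.sum_comm (s := s)]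
  simp only [← Finset.mul_sum, overlap, sub_mul, Finset.sum_sub_distrib]
  ring

theorem HasUnboundedEigenvalues.sum_le (h : HasUnboundedEigenvalues 𝕜 V lam)
    (ho : Orthonormal 𝕜 ψ) (he : ∀ i, ψ i ∈ eigenspace 𝕜 V (lam i)) (hφ : Orthonormal 𝕜 φ)
    (s : Finset ι) (hf : ∀ j ∈ s, HasFiniteEnergy V (φ j)) :
    ∑ k ∈ Finset.range s.card, lam k ≤ ∑ j ∈ s, formEnergy V (φ j) := by
  refine le_trans ?_ (h.sum_bound ho he hφ s hf)
  refine le_add_of_nonneg_right (Finset.sum_nonneg fun k hk => mul_nonneg ?_ ?_)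
  · exact sub_nonneg.mpr (h.monotone (Finset.mem_range.mp hk).le)
  · exact sub_nonneg.mpr (overlap_le_one ho hφ s k)

/-- Equality in the variational principle at a spectral gap forces the spans to agree. -/
theorem HasUnboundedEigenvalues.overlap_eq_one (h : HasUnboundedEigenvalues 𝕜 V lam)
    (ho : Orthonormal 𝕜 ψ) (he : ∀ i, ψ i ∈ eigenspace 𝕜 V (lam i)) (hφ : Orthonormal 𝕜 φ)
    (s : Finset ι) (hf : ∀ j ∈ s, HasFiniteEnergy V (φ j))
    (heq : ∑ j ∈ s, formEnergy V (φ j) = ∑ k ∈ Finset.range s.card, lam k) {k : ℕ}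
    (hk : k < s.card) (hgap : lam k < lam s.card) : overlap ψ φ s k = 1 := by
  have h1 := h.sum_bound ho he hφ s hf
  rw [heq] at h1
  have hnn : ∀ k ∈ Finset.range s.card, 0 ≤ (lam s.card - lam k) * (1 - overlap ψ φ s k) :=
    fun k hk => mul_nonneg (sub_nonneg.mpr (h.monotone (Finset.mem_range.mp hk).le))
      (sub_nonneg.mpr (overlap_le_one ho hφ s k))
  have h2 := (Finset.sum_eq_zero_iff_of_nonneg hnn).mp
    (le_antisymm (by linarith) (Finset.sum_nonneg hnn)) k (Finset.mem_range.mpr hk)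
  rcases mul_eq_zero.mp h2 with h3 | h3 <;> linarith

end MinMax

/-! ### Complex conjugation and real eigenfunctions. -/

section RealEigenfunctions

variable {d : ℕ} {𝕜 : Type} [RCLike 𝕜] {V : EuclideanSpace ℝ (Fin d) → ℝ} {lam : ℕ → ℝ}

theorem coeFn_star_L2 (f : L2 d 𝕜) : ∀ᵐ x, (star f : L2 d 𝕜) x = (starRingEnd 𝕜) (f x) := by
  filter_upwards [Lp.coeFn_star f] with x hx
  rw [hx, Pi.star_apply, starRingEnd_apply]

theorem star_add_L2 (f g : L2 d 𝕜) : star (f + g) = star f + star g := by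
  apply Lp.ext
  filter_upwards [coeFn_star_L2 (f + g), coeFn_star_L2 f, coeFn_star_L2 g, Lp.coeFn_add f g,
    Lp.coeFn_add (star f) (star g)] with x h1 h2 h3 h4 h5
  rw [h1, h4, h5, Pi.add_apply, Pi.add_apply, h2, h3, map_add]

theorem star_smul_L2 (c : 𝕜) (f : L2 d 𝕜) : star (c • f) = (starRingEnd 𝕜) c • star f := by
  apply Lp.ext
  filter_upwards [coeFn_star_L2 (c • f), coeFn_star_L2 f, Lp.coeFn_smul c f,
    Lp.coeFn_smul ((starRingEnd 𝕜) c) (star f)] with x h1 h2 h3 h4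
  rw [h1, h3, h4, Pi.smul_apply, Pi.smul_apply, h2, smul_eq_mul, smul_eq_mul, map_mul]

theorem star_sub_L2 (f g : L2 d 𝕜) : star (f - g) = star f - star g := by
  rw [sub_eq_add_neg, ← neg_one_smul 𝕜 g, star_add_L2, star_smul_L2]
  simp [sub_eq_add_neg]

theorem star_zero_L2 : star (0 : L2 d 𝕜) = 0 := by
  simpa using star_smul_L2 (0 : 𝕜) (0 : L2 d 𝕜)

theorem star_sum_L2 {ι : Type*} (s : Finset ι) (f : ι → L2 d 𝕜) :
    star (∑ i ∈ s, f i) = ∑ i ∈ s, star (f i) := by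
  classical
  induction s using Finset.induction_on with
  | empty => simpa using star_zero_L2
  | insert a s ha ih => rw [Finset.sum_insert ha, Finset.sum_insert ha, star_add_L2, ih]

theorem inner_star_star (f g : L2 d 𝕜) :
    (inner 𝕜 (star f) (star g) : 𝕜) = (starRingEnd 𝕜) (inner 𝕜 f g) := by
  rw [L2.inner_def, L2.inner_def, ← integral_conj]
  apply integral_congr_ae
  filter_upwards [coeFn_star_L2 f, coeFn_star_L2 g] with x h1 h2
  rw [h1, h2]
  simp [RCLike.inner_apply]

theorem IsWeakPartial.star {j : Fin d} {ψ g : L2 d 𝕜} (h : IsWeakPartial j ψ g) :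
    IsWeakPartial j (star ψ) (star g) := by
  intro φ hφ hc
  have e : ∀ (a : EuclideanSpace ℝ (Fin d) → ℝ) (f : L2 d 𝕜),
      ∫ x, a x • (Star.star f : L2 d 𝕜) x = (starRingEnd 𝕜) (∫ x, a x • f x) := by
    intro a f
    rw [← integral_conj]
    apply integral_congr_ae
    filter_upwards [coeFn_star_L2 f] with x hx
    rw [hx, RCLike.real_smul_eq_coe_mul, RCLike.real_smul_eq_coe_mul, map_mul, RCLike.conj_ofReal]
  rw [e, e, h φ hφ hc, map_neg]

theorem HasFiniteEnergy.star {ψ : L2 d 𝕜} (h : HasFiniteEnergy V ψ) :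
    HasFiniteEnergy V (star ψ) := by
  refine ⟨fun j => ?_, h.2.congr ?_⟩
  · obtain ⟨g, hg⟩ := h.1 j
    exact ⟨_, hg.star⟩
  · filter_upwards [coeFn_star_L2 ψ] with x hx
    rw [hx, RCLike.norm_conj]

theorem energyForm_star_star {φ ψ : L2 d 𝕜} (hφ : HasFiniteEnergy V φ)
    (hψ : HasFiniteEnergy V ψ) :
    energyForm V (star φ) (star ψ) = (starRingEnd 𝕜) (energyForm V φ ψ) := by
  have hw : ∀ {χ : L2 d 𝕜} (_ : HasFiniteEnergy V χ) (j : Fin d),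
      weakPartial j (star χ) = star (weakPartial j χ) := fun h j =>
    (isWeakPartial_weakPartial (h.1 j)).star.weakPartial_eq
  simp only [energyForm, hw hφ, hw hψ, inner_star_star, map_add, map_sum, ← integral_conj]
  congr 1
  apply integral_congr_ae
  filter_upwards [coeFn_star_L2 φ, coeFn_star_L2 ψ] with x h1 h2
  rw [h1, h2]
  simp [RCLike.inner_apply]

/-- The potential, the test functions in the weak derivative and `μ` are all real, so the eigenvalue
equation may be conjugated. -/
theorem star_mem_eigenspace {μ : ℝ} {ψ : L2 d 𝕜} (h : ψ ∈ eigenspace 𝕜 V μ) :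
    star ψ ∈ eigenspace 𝕜 V μ := by
  have fψ := finiteEnergy_of_mem_eigenspace h
  refine mem_eigenspace.mpr ⟨fψ.star, fun φ hφ => ?_⟩
  have h1 := energyForm_star_star hφ.star fψ
  rw [star_star, energyForm_eigen_right hφ.star h] at h1
  rw [h1, inner_smul_right, map_mul, RCLike.conj_ofReal, ← inner_star_star, star_star]

theorem span_real_eigenspace {μ : ℝ} :
    Submodule.span 𝕜 {f : L2 d 𝕜 | f ∈ eigenspace 𝕜 V μ ∧ star f = f} = eigenspace 𝕜 V μ := by
  refine le_antisymm (Submodule.span_le.mpr fun f hf => hf.1) fun f hf => ?_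
  have hs := star_mem_eigenspace hf
  have h1 : f + star f ∈ Submodule.span 𝕜 {f : L2 d 𝕜 | f ∈ eigenspace 𝕜 V μ ∧ star f = f} :=
    Submodule.subset_span ⟨Submodule.add_mem _ hf hs, by rw [star_add_L2, star_star, add_comm]⟩
  have h2 : f - star f ∈ Submodule.span 𝕜 {f : L2 d 𝕜 | f ∈ eigenspace 𝕜 V μ ∧ star f = f} := by
    -- Either `I = 0`, the real case, where conjugation is trivial, or `I * I = -1`, where `I • (f -
    -- star f)` is fixed by conjugation.
    rcases RCLike.I_mul_I (K := 𝕜) with hI | hI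
    · have : star f = f := by
        apply Lp.ext
        filter_upwards [coeFn_star_L2 f] with x hx
        rw [hx, RCLike.conj_eq_re_sub_im, hI, mul_zero, sub_zero]
        conv_rhs => rw [← RCLike.re_add_im (f x), hI, mul_zero, add_zero]
      rw [this, sub_self]
      exact Submodule.zero_mem _
    · have h3 : (RCLike.I : 𝕜) • (f - star f) ∈
          Submodule.span 𝕜 {f : L2 d 𝕜 | f ∈ eigenspace 𝕜 V μ ∧ star f = f} := by
        refine Submodule.subset_span
          ⟨Submodule.smul_mem _ _ (Submodule.sub_mem _ hf hs), ?_⟩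
        rw [star_smul_L2, star_sub_L2, star_star, RCLike.conj_I, neg_smul, ← smul_neg, neg_sub]
      have h4 := Submodule.smul_mem _ (-(RCLike.I : 𝕜)) h3
      rwa [smul_smul, neg_mul, hI, neg_neg, one_smul] at h4
  have h5 := Submodule.smul_mem _ (2⁻¹ : 𝕜) (Submodule.add_mem _ h1 h2)
  have h6 : (2⁻¹ : 𝕜) • ((f + star f) + (f - star f)) = f := by
    rw [add_add_sub_cancel, ← two_smul 𝕜 f, smul_smul, inv_mul_cancel₀ two_ne_zero, one_smul]
  rwa [h6] at h5

open InnerProductSpace in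
-- Inner products of conjugation-invariant functions are real, so Gram–Schmidt only takes real
-- combinations.
theorem star_gramSchmidt {n : ℕ} {f : Fin n → L2 d 𝕜} (h : ∀ i, star (f i) = f i) (i : Fin n) :
    star (gramSchmidt 𝕜 f i) = gramSchmidt 𝕜 f i := by
  induction i using WellFoundedLT.induction with
  | ind i ih =>
    rw [gramSchmidt_def, star_sub_L2, h, star_sum_L2]
    congr 1
    refine Finset.sum_congr rfl fun j hj => ?_
    have hj' := ih j (Finset.mem_Iio.mp hj)
    have hin : (starRingEnd 𝕜) (inner 𝕜 (gramSchmidt 𝕜 f j) (f i)) =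
        inner 𝕜 (gramSchmidt 𝕜 f j) (f i) := by rw [← inner_star_star, hj', h]
    rw [Submodule.starProjection_singleton, star_smul_L2, hj', map_div₀, hin, RCLike.conj_ofReal]

open InnerProductSpace in
theorem exists_real_orthonormal_eigenspace (V : EuclideanSpace ℝ (Fin d) → ℝ) {μ : ℝ} {n : ℕ}
    (hn : Module.finrank 𝕜 (eigenspace 𝕜 V μ) = n) (hpos : 0 < n) :
    ∃ f : Fin n → L2 d 𝕜, Orthonormal 𝕜 f ∧ ∀ i, f i ∈ eigenspace 𝕜 V μ ∧ star (f i) = f i := by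
  have : FiniteDimensional 𝕜 (eigenspace 𝕜 V μ) := Module.finite_of_finrank_pos (hn ▸ hpos)
  have hspan := span_real_eigenspace (d := d) (𝕜 := 𝕜) (V := V) (μ := μ)
  have : FiniteDimensional 𝕜
      (Submodule.span 𝕜 {f : L2 d 𝕜 | f ∈ eigenspace 𝕜 V μ ∧ star f = f}) := by
    rw [hspan]; assumption
  obtain ⟨f, h1, h2, h3⟩ := Submodule.exists_fun_fin_finrank_span_eq 𝕜
    {f : L2 d 𝕜 | f ∈ eigenspace 𝕜 V μ ∧ star f = f}
  have hc : n = Module.finrank 𝕜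
      (Submodule.span 𝕜 {f : L2 d 𝕜 | f ∈ eigenspace 𝕜 V μ ∧ star f = f}) := by rw [hspan, hn]
  rw [hc]
  refine ⟨gramSchmidtNormed 𝕜 f, gramSchmidtNormed_orthonormal h3, fun i => ⟨?_, ?_⟩⟩
  · refine Submodule.smul_mem _ _ ?_
    have hm : gramSchmidt 𝕜 f i ∈ Submodule.span 𝕜 (Set.range f) := by
      rw [← span_gramSchmidt]
      exact Submodule.subset_span ⟨i, rfl⟩
    rw [h2] at hm
    exact hspan.le hm
  · rw [gramSchmidtNormed, star_smul_L2, star_gramSchmidt fun i => (h1 i).2, map_inv₀,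
      RCLike.conj_ofReal]

/-- Finiteness keeps `Nat.card` in the multiplicity condition from being its default value `0`, so
eigenspaces of the `lam i` have positive finite dimension. -/
theorem HasUnboundedEigenvalues.finite_fiber (h : HasUnboundedEigenvalues 𝕜 V lam) (μ : ℝ) :
    Finite {j : ℕ // lam j = μ} := by
  obtain ⟨N, hN⟩ := (tendsto_atTop_atTop.mp h.tendsto) (μ + 1)
  refine ((Set.finite_lt_nat N).subset fun j (hj : lam j = μ) => ?_).to_subtype
  by_contra hjN
  have := hN j (not_lt.mp hjN)
  linarith

/-- There is an orthonormal sequence of real valued eigenfunctions. -/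
theorem HasUnboundedEigenvalues.exists_real_eigenfunctions
    (h : HasUnboundedEigenvalues 𝕜 V lam) :
    ∃ ψ : ℕ → L2 d 𝕜, Orthonormal 𝕜 ψ ∧ (∀ i, ψ i ∈ eigenspace 𝕜 V (lam i)) ∧
      ∀ i, ∀ᵐ x, RCLike.im (ψ i x) = 0 := by
  have key : ∀ μ : Set.range lam, ∃ f : {j : ℕ // lam j = μ} → L2 d 𝕜, Orthonormal 𝕜 f ∧
      ∀ i, f i ∈ eigenspace 𝕜 V μ ∧ star (f i) = f i := by
    rintro ⟨_, i, rfl⟩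
    have := h.finite_fiber (lam i)
    have : Nonempty {j : ℕ // lam j = lam i} := ⟨⟨i, rfl⟩⟩
    obtain ⟨f, h1, h2⟩ := exists_real_orthonormal_eigenspace V (h.multiplicity i) Nat.card_pos
    exact ⟨f ∘ Finite.equivFin _, h1.comp _ (Equiv.injective _), fun j => h2 _⟩
  choose f hfo hf using key
  have hort : ∀ (μ ν : Set.range lam) (a : {j : ℕ // lam j = μ}) (b : {j : ℕ // lam j = ν}),
      a.1 ≠ b.1 → (inner 𝕜 (f μ a) (f ν b) : 𝕜) = 0 := by
    intro μ ν a b hab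
    by_cases hμ : μ = ν
    · subst hμ
      exact (hfo μ).2 fun he => hab (congrArg Subtype.val he)
    · exact inner_eq_zero_of_eigenspace_ne (fun he => hμ (Subtype.ext he)) (hf _ a).1 (hf _ b).1
  -- The basis of each eigenspace is indexed by the fiber of `lam`, so the bases glue to one
  -- sequence.
  obtain ⟨g, hg⟩ : ∃ g : ℕ → L2 d 𝕜, ∀ i, g i = f ⟨lam i, i, rfl⟩ ⟨i, rfl⟩ := ⟨_, fun _ => rfl⟩
  have hgs : ∀ i, star (g i) = g i := fun i => by rw [hg]; exact (hf ⟨lam i, i, rfl⟩ ⟨i, rfl⟩).2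
  refine ⟨g, ⟨fun i => ?_, fun i j hij => ?_⟩, fun i => ?_, fun i => ?_⟩
  · rw [hg]
    exact (hfo ⟨lam i, i, rfl⟩).1 ⟨i, rfl⟩
  · change (inner 𝕜 (g i) (g j) : 𝕜) = 0
    rw [hg, hg]
    exact hort _ _ _ _ hij
  · rw [hg]
    exact (hf ⟨lam i, i, rfl⟩ ⟨i, rfl⟩).1
  · filter_upwards [coeFn_star_L2 (g i)] with x hx
    rw [hgs] at hx
    exact RCLike.conj_eq_iff_im.mp hx.symm

end RealEigenfunctions

/-! ### Series with extended real terms. -/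

section ExtendedSum

theorem extendedSum_coe {r : ℕ → ℝ} (hr : Summable r) :
    extendedSum (fun i => (r i : EReal)) = ((∑' i, r i : ℝ) : EReal) := by
  have hpos : ∀ {s : ℕ → ℝ}, Summable s →
      Summable (fun i => max (s i) 0) ∧
        ((∑' i, ENNReal.ofReal (s i) : ℝ≥0∞) : EReal) = ((∑' i, max (s i) 0 : ℝ) : EReal) := by
    intro s hs
    have h1 : Summable fun i => max (s i) 0 :=
      Summable.of_nonneg_of_le (fun i => le_max_right _ _)
        (fun i => max_le (le_abs_self _) (abs_nonneg _)) hs.abs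
    refine ⟨h1, ?_⟩
    have h2 : ∀ i, ENNReal.ofReal (s i) = ENNReal.ofReal (max (s i) 0) := fun i => by
      rcases le_total (s i) 0 with h | h
      · rw [max_eq_right h, ENNReal.ofReal_of_nonpos h, ENNReal.ofReal_zero]
      · rw [max_eq_left h]
    simp_rw [h2]
    rw [← ENNReal.ofReal_tsum_of_nonneg (fun i => le_max_right _ _) h1, EReal.coe_ennreal_ofReal,
      max_eq_left (tsum_nonneg fun i => le_max_right _ _)]
  have e1 : ∀ i, ((r i : ℝ) : EReal).toENNReal = ENNReal.ofReal (r i) := fun i => rfl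
  have e2 : ∀ i, (-((r i : ℝ) : EReal)).toENNReal = ENNReal.ofReal (-r i) := fun i => rfl
  obtain ⟨h1, h1'⟩ := hpos hr
  obtain ⟨h2, h2'⟩ := hpos hr.neg
  rw [extendedSum]
  simp_rw [e1, e2]
  rw [h1', h2', ← EReal.coe_sub, ← h1.tsum_sub h2]
  congr 2
  funext i
  rcases le_total (r i) 0 with h | h
  · rw [max_eq_right h, max_eq_left (by linarith)]
    ring
  · rw [max_eq_left h, max_eq_right (by linarith)]
    ring

/-- With a finite negative part, only the positive part can diverge; if it does not, all terms are
real and both parts are summable. -/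
theorem extendedSum_eq_top_or {a : ℕ → EReal} (h : ∑' i, (-a i).toENNReal ≠ ⊤) :
    extendedSum a = ⊤ ∨ ∃ r : ℕ → ℝ, Summable r ∧ ∀ i, a i = r i := by
  by_cases hP : ∑' i, (a i).toENNReal = ⊤
  · left
    rw [extendedSum, hP, ← ENNReal.ofReal_toReal h, EReal.coe_ennreal_ofReal,
      EReal.coe_ennreal_top, EReal.top_sub_coe]
  · right
    have h1 : ∀ i, a i ≠ ⊤ := fun i hi =>
      ENNReal.ne_top_of_tsum_ne_top hP i (EReal.toENNReal_eq_top_iff.mpr hi)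
    have h2 : ∀ i, a i ≠ ⊥ := fun i hi =>
      ENNReal.ne_top_of_tsum_ne_top h i (EReal.toENNReal_eq_top_iff.mpr (by rw [hi]; rfl))
    have h3 : ∀ i, a i = ((a i).toReal : EReal) := fun i => (EReal.coe_toReal (h1 i) (h2 i)).symm
    refine ⟨fun i => (a i).toReal, ?_, h3⟩
    have s1 := ENNReal.summable_toReal hP
    have s2 := ENNReal.summable_toReal h
    refine (s1.sub s2).congr fun i => ?_
    have e1 : (a i).toENNReal = ENNReal.ofReal (a i).toReal := by rw [h3 i]; rfl
    have e2 : (-a i).toENNReal = ENNReal.ofReal (-(a i).toReal) := by rw [h3 i]; rfl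
    rw [e1, e2, ENNReal.toReal_ofReal', ENNReal.toReal_ofReal']
    rcases le_total (a i).toReal 0 with h | h
    · rw [max_eq_right h, max_eq_left (by linarith)]
      ring
    · rw [max_eq_left h, max_eq_right (by linarith)]
      ring

end ExtendedSum

/-! ### The scalar variational problem for occupation numbers. -/

section Scalar

theorem IsInverseDeriv.mem {D : Set ℝ} {β : ℝ → ℝ} {s ν : ℝ} (h0 : (0 : ℝ) ∈ D)
    (h : IsInverseDeriv D β s ν) : ν ∈ D := by
  rcases h with ⟨h, -⟩ | ⟨rfl, -⟩
  · exact interior_subset h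
  · exact h0

/-- `(β')⁻¹(s)` is the strict minimizer of `β t - s t`. -/
theorem IsInverseDeriv.lt {D : Set ℝ} {β : ℝ → ℝ} {s ν : ℝ} (hD : D ⊆ Set.Ici 0)
    (hβ : StrictConvexOn ℝ D β) (h0 : (0 : ℝ) ∈ D) (hd : DifferentiableOn ℝ β (interior D))
    (h : IsInverseDeriv D β s ν) {t : ℝ} (ht : t ∈ D) (htν : t ≠ ν) :
    β ν - s * ν < β t - s * t := by
  rcases h with ⟨hν, hs⟩ | ⟨rfl, hs⟩
  · have hder : HasDerivAt β s ν :=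
      hs ▸ ((hd ν hν).differentiableAt (isOpen_interior.mem_nhds hν)).hasDerivAt
    rcases lt_or_gt_of_ne htν with hlt | hlt
    · have := hβ.slope_lt_of_hasDerivAt ht (interior_subset hν) hlt hder
      rw [slope_def_field, div_lt_iff₀ (by linarith)] at this
      linarith
    · have := hβ.lt_slope_of_hasDerivAt (interior_subset hν) ht hlt hder
      rw [slope_def_field, lt_div_iff₀ (by linarith)] at this
      linarith
  · have htpos : 0 < t := lt_of_le_of_ne (hD ht) (Ne.symm htν)
    -- The slope condition at `0` is not strict; applying it at the midpoint `t / 2` and using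
    -- strict convexity on `[0, t]` recovers strictness.
    have hm : (1 / 2 : ℝ) * 0 + (1 / 2) * t ∈ D :=
      hβ.1 h0 ht (by norm_num) (by norm_num) (by norm_num)
    have h1 := hβ.2 h0 ht htν.symm (show (0 : ℝ) < 1 / 2 by norm_num)
      (show (0 : ℝ) < 1 / 2 by norm_num) (by norm_num)
    have h2 := hs _ hm (by linarith)
    rw [le_div_iff₀ (by linarith)] at h2
    simp only [smul_eq_mul] at h1
    linarith

variable {d : ℕ} {𝕜 : Type} [RCLike 𝕜] {D : Set ℝ} {β : ℝ → ℝ}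
  {V : EuclideanSpace ℝ (Fin d) → ℝ} {lam nubar : ℕ → ℝ}

theorem AssumptionH.nubar_mem (hH : AssumptionH 𝕜 D β V lam nubar) (i : ℕ) : nubar i ∈ D :=
  (hH.inverse i).mem hH.zero_mem

theorem AssumptionH.nubar_nonneg (hH : AssumptionH 𝕜 D β V lam nubar) (i : ℕ) : 0 ≤ nubar i :=
  hH.domain_nonneg (hH.nubar_mem i)

theorem AssumptionH.lt (hH : AssumptionH 𝕜 D β V lam nubar) (i : ℕ) {t : ℝ} (ht : t ∈ D)
    (hne : t ≠ nubar i) : β (nubar i) + nubar i * lam i < β t + t * lam i := by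
  have := (hH.inverse i).lt hH.domain_nonneg hH.strictConvex hH.zero_mem
    (hH.contDiff.differentiableOn (by norm_num)) ht hne
  linarith

theorem AssumptionH.le (hH : AssumptionH 𝕜 D β V lam nubar) (i : ℕ) {t : ℝ} (ht : t ∈ D) :
    β (nubar i) + nubar i * lam i ≤ β t + t * lam i := by
  by_cases h : t = nubar i
  · rw [h]
  · exact (hH.lt i ht h).le

/-- Testing each scalar problem with the other's minimizer and adding cancels `β`, leaving the sign
of `(nubar j - nubar i) * (lam j - lam i)`. -/
theorem AssumptionH.antitone (hH : AssumptionH 𝕜 D β V lam nubar) : Antitone nubar := by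
  intro i j hij
  by_contra! hlt
  have h1 := hH.lt i (hH.nubar_mem j) hlt.ne'
  have h2 := hH.lt j (hH.nubar_mem i) hlt.ne
  have h3 := hH.eigenvalues.monotone hij
  nlinarith [mul_nonneg (sub_nonneg.mpr hlt.le) (sub_nonneg.mpr h3)]

/-- A positive occupation number determines its eigenvalue as `-β'`; at `0` only a slope inequality
is available. -/
theorem AssumptionH.lam_eq (hH : AssumptionH 𝕜 D β V lam nubar) {i j : ℕ} (hi : 0 < nubar i)
    (hij : nubar i = nubar j) : lam i = lam j := by
  have h1 := hH.inverse i
  have h2 := hH.inverse j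
  rcases h1 with ⟨-, h1⟩ | ⟨h1, -⟩
  · rcases h2 with ⟨-, h2⟩ | ⟨h2, -⟩
    · rw [hij, h2] at h1
      linarith
    · linarith
  · linarith

theorem AssumptionH.tendsto_nubar (hH : AssumptionH 𝕜 D β V lam nubar) :
    Tendsto nubar atTop (𝓝 0) := by
  -- Testing problem `0` with `nubar i` and problem `i` with `0` eliminates `β (nubar i)`; the bound
  -- is uniform in `i`.
  have h1 : ∀ i, nubar i * (lam i - lam 0) ≤ -(β (nubar 0) + nubar 0 * lam 0) := fun i => by
    have h2 := hH.le 0 (hH.nubar_mem i)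
    have h3 := hH.le i hH.zero_mem
    rw [hH.map_zero] at h3
    linarith
  have h4 : Tendsto (fun i => -(β (nubar 0) + nubar 0 * lam 0) / (lam i - lam 0)) atTop (𝓝 0) :=
    (tendsto_atTop_add_const_right _ (-lam 0) hH.eigenvalues.tendsto).const_div_atTop _
  refine squeeze_zero' (Eventually.of_forall hH.nubar_nonneg) ?_ h4
  filter_upwards [hH.eigenvalues.tendsto.eventually_gt_atTop (lam 0)] with i hi
  rw [le_div_iff₀ (by linarith)]
  exact h1 i

theorem summable_of_tendsto_of_eventually_nonneg {f : ℕ → ℝ} {a : ℝ}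
    (h : Tendsto (fun n => ∑ i ∈ Finset.range n, f i) atTop (𝓝 a))
    (h0 : ∀ᶠ i in atTop, 0 ≤ f i) : Summable f := by
  obtain ⟨N, hN⟩ := eventually_atTop.mp h0
  rw [← summable_nat_add_iff N]
  have h1 : Tendsto (fun n => ∑ i ∈ Finset.range n, f (i + N)) atTop
      (𝓝 (a - ∑ i ∈ Finset.range N, f i)) := by
    have h2 := (h.comp (tendsto_add_atTop_nat N)).sub_const (∑ i ∈ Finset.range N, f i)
    refine h2.congr fun n => ?_
    rw [Function.comp_apply, add_comm n N, Finset.sum_range_add, add_sub_cancel_left]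
    simp only [add_comm N]
  exact ((hasSum_iff_tendsto_nat_of_nonneg (fun i => hN _ (by omega)) _).mpr h1).summable

theorem AssumptionH.summable_energy (hH : AssumptionH 𝕜 D β V lam nubar) :
    Summable fun i => nubar i * lam i := by
  obtain ⟨b, hb⟩ := hH.energy_converges
  refine summable_of_tendsto_of_eventually_nonneg hb ?_
  filter_upwards [hH.eigenvalues.tendsto.eventually_ge_atTop 0] with i hi
  exact mul_nonneg (hH.nubar_nonneg i) hi

/-- Once `lam i ≥ 0`, comparison with `t = 0` gives `β (nubar i) ≤ -nubar i * lam i ≤ 0`, so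
convergence of partial sums is absolute. -/
theorem AssumptionH.summable_entropy (hH : AssumptionH 𝕜 D β V lam nubar) :
    Summable fun i => β (nubar i) := by
  obtain ⟨a, ha⟩ := hH.entropy_converges
  have h1 : Tendsto (fun n => ∑ i ∈ Finset.range n, -β (nubar i)) atTop (𝓝 (-a)) := by
    simpa only [Finset.sum_neg_distrib] using ha.neg
  refine (summable_of_tendsto_of_eventually_nonneg h1 ?_).of_neg
  filter_upwards [hH.eigenvalues.tendsto.eventually_ge_atTop 0] with i hi
  have h3 := hH.le i hH.zero_mem
  rw [hH.map_zero] at h3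
  have := mul_nonneg (hH.nubar_nonneg i) hi
  linarith

theorem AssumptionH.nubar_mem_occupationNumbers (hH : AssumptionH 𝕜 D β V lam nubar) :
    nubar ∈ occupationNumbers D β :=
  ⟨hH.antitone, fun i => ⟨hH.nubar_nonneg i, hH.nubar_mem i⟩, hH.tendsto_nubar,
    hH.summable_entropy.abs⟩

end Scalar

/-! ### Comparison with the eigenfunctions and rigidity of minimizers. -/

section Comparison

variable {d : ℕ} {𝕜 : Type} [RCLike 𝕜] {D : Set ℝ} {β : ℝ → ℝ}
  {V : EuclideanSpace ℝ (Fin d) → ℝ} {lam nubar : ℕ → ℝ} {ψ φ : ℕ → L2 d 𝕜} {ν : ℕ → ℝ}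

theorem HasUnboundedEigenvalues.exists_sum_ge (h : HasUnboundedEigenvalues 𝕜 V lam) :
    ∃ C : ℝ, ∀ n, -C ≤ ∑ k ∈ Finset.range n, lam k := by
  obtain ⟨N, hN⟩ := eventually_atTop.mp (h.tendsto.eventually_ge_atTop 0)
  refine ⟨-∑ k ∈ Finset.range N, min (lam k) 0, fun n => ?_⟩
  rw [neg_neg]
  have h1 : ∑ k ∈ Finset.range (max n N), min (lam k) 0
      = ∑ k ∈ Finset.range N, min (lam k) 0 := by
    refine (Finset.sum_subset (Finset.range_mono (le_max_right _ _)) fun k _ hk => ?_).symm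
    exact min_eq_right (hN k (by simpa using hk))
  rw [← h1]
  refine le_trans ?_ (Finset.sum_le_sum fun k _ => min_le_left (lam k) 0)
  have h2 := Finset.sum_le_sum_of_subset_of_nonneg (f := fun k => -min (lam k) 0)
    (Finset.range_mono (le_max_left n N)) fun k _ _ => neg_nonneg.mpr (min_le_right _ _)
  simp only [Finset.sum_neg_distrib] at h2
  exact neg_le_neg_iff.mp h2

/-- The negative parts of the energies of an orthonormal sequence are summable. -/
theorem HasUnboundedEigenvalues.summable_negPart (h : HasUnboundedEigenvalues 𝕜 V lam)
    (ho : Orthonormal 𝕜 ψ) (he : ∀ i, ψ i ∈ eigenspace 𝕜 V (lam i)) (hφ : Orthonormal 𝕜 φ) :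
    Summable fun i => ENNReal.toReal (-energy V (φ i)).toENNReal := by
  classical
  obtain ⟨C, hC⟩ := h.exists_sum_ge
  refine summable_of_sum_le (c := C) (fun i => ENNReal.toReal_nonneg) fun s => ?_
  have hneg : ∀ i, ENNReal.toReal (-energy V (φ i)).toENNReal =
      if HasFiniteEnergy V (φ i) ∧ formEnergy V (φ i) < 0 then -formEnergy V (φ i) else 0 := by
    intro i
    by_cases hf : HasFiniteEnergy V (φ i)
    · rw [hf.energy_eq, ← EReal.coe_neg, EReal.real_coe_toENNReal, ENNReal.toReal_ofReal']
      by_cases hlt : formEnergy V (φ i) < 0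
      · rw [if_pos ⟨hf, hlt⟩, max_eq_left (by linarith)]
      · rw [if_neg fun h => hlt h.2, max_eq_right (by linarith)]
    · rw [energy_eq_top hf, if_neg fun h => hf h.1]
      simp
  simp_rw [hneg]
  rw [← Finset.sum_filter, Finset.sum_neg_distrib]
  -- Restricted to the functions of negative energy, the variational principle bounds the sum by the
  -- uniform constant `C`.
  have := h.sum_le ho he hφ (s.filter fun i => HasFiniteEnergy V (φ i) ∧ formEnergy V (φ i) < 0)
    fun j hj => (Finset.mem_filter.mp hj).2.1
  linarith [hC (s.filter fun i => HasFiniteEnergy V (φ i) ∧ formEnergy V (φ i) < 0).card]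

/-- The free energy of an admissible pair is `+∞` or given by absolutely convergent series. -/
theorem HasUnboundedEigenvalues.freeEnergy_eq_top_or (h : HasUnboundedEigenvalues 𝕜 V lam)
    (ho : Orthonormal 𝕜 ψ) (he : ∀ i, ψ i ∈ eigenspace 𝕜 V (lam i)) (hφ : Orthonormal 𝕜 φ)
    (hν : ν ∈ occupationNumbers D β) :
    freeEnergy β V ν φ = ⊤ ∨ ((∀ i, 0 < ν i → HasFiniteEnergy V (φ i)) ∧
      Summable (fun i => ν i * formEnergy V (φ i)) ∧
      freeEnergy β V ν φ
        = (((∑' i, β (ν i)) + ∑' i, ν i * formEnergy V (φ i) : ℝ) : EReal)) := by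
  have hneg : ∑' i, (-((ν i : EReal) * energy V (φ i))).toENNReal ≠ ⊤ := by
    -- Since `ν i ≤ ν 0`, the negative parts of the weighted energies are dominated by this series.
    have hs := (h.summable_negPart ho he hφ).mul_left (ν 0)
    refine ne_top_of_le_ne_top hs.tsum_ofReal_ne_top (ENNReal.tsum_le_tsum fun i => ?_)
    have h0 : (0 : EReal) ≤ (ν i : EReal) := EReal.coe_nonneg.mpr (hν.2.1 i).1
    have hfin : (-energy V (φ i)).toENNReal ≠ ⊤ := by
      rw [EReal.toENNReal_ne_top_iff]
      by_cases hf : HasFiniteEnergy V (φ i)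
      · rw [hf.energy_eq, ← EReal.coe_neg]
        exact EReal.coe_ne_top _
      · rw [energy_eq_top hf]
        simp
    rw [← mul_neg, EReal.toENNReal_mul h0, ENNReal.ofReal_mul (hν.2.1 0).1,
      ENNReal.ofReal_toReal hfin]
    gcongr
    exact ENNReal.ofReal_le_ofReal (hν.1 (Nat.zero_le i))
  rcases extendedSum_eq_top_or hneg with htop | ⟨r, hr, hra⟩
  · left
    rw [freeEnergy, htop, EReal.coe_add_top]
  · right
    have hf : ∀ i, 0 < ν i → HasFiniteEnergy V (φ i) := by
      intro i hi
      by_contra hf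
      have h1 := hra i
      rw [energy_eq_top hf, EReal.coe_mul_top_of_pos hi] at h1
      exact EReal.coe_ne_top _ h1.symm
    have hreq : ∀ i, r i = ν i * formEnergy V (φ i) := by
      intro i
      rcases (hν.2.1 i).1.eq_or_lt with h0 | h0
      · have h1 := hra i
        rw [← h0, EReal.coe_zero, zero_mul] at h1
        rw [← h0, zero_mul]
        exact_mod_cast h1.symm
      · have h1 := hra i
        rw [(hf i h0).energy_eq, ← EReal.coe_mul] at h1
        exact_mod_cast h1.symm
    have hr' : Summable fun i => ν i * formEnergy V (φ i) := hr.congr hreq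
    refine ⟨hf, hr', ?_⟩
    rw [freeEnergy]
    simp_rw [hra]
    rw [extendedSum_coe hr, ← EReal.coe_add]
    simp_rw [hreq]

/-- Summation by parts. -/
theorem sum_range_mul_eq (ν f : ℕ → ℝ) (n : ℕ) :
    ∑ i ∈ Finset.range n, ν i * f i
      = ∑ i ∈ Finset.range n, (ν i - ν (i + 1)) * ∑ j ∈ Finset.range (i + 1), f j
        + ν n * ∑ j ∈ Finset.range n, f j := by
  induction n with
  | zero => simp
  | succ n ih =>
    rw [Finset.sum_range_succ, ih, Finset.sum_range_succ (n := n), Finset.sum_range_succ f n]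
    ring

/-- The excess of the energy of the first `n` functions over the sum of the lowest eigenvalues. -/
noncomputable def excess (V : EuclideanSpace ℝ (Fin d) → ℝ) (lam : ℕ → ℝ) (φ : ℕ → L2 d 𝕜)
    (n : ℕ) : ℝ :=
  ∑ j ∈ Finset.range n, (formEnergy V (φ j) - lam j)

theorem HasUnboundedEigenvalues.excess_nonneg (h : HasUnboundedEigenvalues 𝕜 V lam)
    (ho : Orthonormal 𝕜 ψ) (he : ∀ i, ψ i ∈ eigenspace 𝕜 V (lam i)) (hφ : Orthonormal 𝕜 φ)
    {n : ℕ} (hf : ∀ j < n, HasFiniteEnergy V (φ j)) : 0 ≤ excess V lam φ n := by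
  have := h.sum_le ho he hφ (Finset.range n) fun j hj => hf j (Finset.mem_range.mp hj)
  rw [Finset.card_range] at this
  rw [excess, Finset.sum_sub_distrib]
  linarith

/-- If `ν n > 0`, monotonicity gives all `φ j` with `j ≤ n` finite energy. If `ν n = 0`, both
weights vanish and the possibly meaningless excess is harmless. -/
theorem HasUnboundedEigenvalues.mul_excess_nonneg (h : HasUnboundedEigenvalues 𝕜 V lam)
    (ho : Orthonormal 𝕜 ψ) (he : ∀ i, ψ i ∈ eigenspace 𝕜 V (lam i)) (hφ : Orthonormal 𝕜 φ)
    (hν : ν ∈ occupationNumbers D β) (hf : ∀ i, 0 < ν i → HasFiniteEnergy V (φ i)) (n : ℕ) :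
    0 ≤ (ν n - ν (n + 1)) * excess V lam φ (n + 1) ∧ 0 ≤ ν n * excess V lam φ n := by
  have hanti : ν (n + 1) ≤ ν n := hν.1 (Nat.le_succ n)
  rcases (hν.2.1 n).1.eq_or_lt with h0 | h0
  · have h1 : ν (n + 1) = 0 := le_antisymm (h0 ▸ hanti) (hν.2.1 _).1
    simp [← h0, h1]
  · have hf' : ∀ j < n + 1, HasFiniteEnergy V (φ j) := fun j hj =>
      hf j (lt_of_lt_of_le h0 (hν.1 (Nat.lt_succ_iff.mp hj)))
    exact ⟨mul_nonneg (sub_nonneg.mpr hanti) (h.excess_nonneg ho he hφ hf'),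
      mul_nonneg h0.le (h.excess_nonneg ho he hφ fun j hj => hf' j (by omega))⟩

/-- The pointwise gap in the scalar variational problem for the occupation numbers. -/
def entropyGap (β : ℝ → ℝ) (lam nubar ν : ℕ → ℝ) (i : ℕ) : ℝ :=
  (β (ν i) + ν i * lam i) - (β (nubar i) + nubar i * lam i)

theorem AssumptionH.entropyGap_nonneg (hH : AssumptionH 𝕜 D β V lam nubar)
    (hν : ν ∈ occupationNumbers D β) (i : ℕ) : 0 ≤ entropyGap β lam nubar ν i :=
  sub_nonneg.mpr (hH.le i (hν.2.1 i).2)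

/-- The quantitative comparison of an admissible pair with the eigenfunctions. -/
theorem AssumptionH.sum_gap_le (hH : AssumptionH 𝕜 D β V lam nubar)
    (ho : Orthonormal 𝕜 ψ) (he : ∀ i, ψ i ∈ eigenspace 𝕜 V (lam i)) (hφ : Orthonormal 𝕜 φ)
    (hν : ν ∈ occupationNumbers D β) (hf : ∀ i, 0 < ν i → HasFiniteEnergy V (φ i))
    (hs : Summable fun i => ν i * formEnergy V (φ i)) (m : ℕ) :
    ∑ i ∈ Finset.range m,
        (entropyGap β lam nubar ν i + (ν i - ν (i + 1)) * excess V lam φ (i + 1))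
      ≤ ((∑' i, β (ν i)) + ∑' i, ν i * formEnergy V (φ i))
        - ((∑' i, β (nubar i)) + ∑' i, nubar i * lam i) := by
  have hE := hH.eigenvalues
  have hsβ : Summable fun i => β (ν i) := hν.2.2.2.of_abs
  have hlim := ((hsβ.hasSum.add hs.hasSum).sub
    (hH.summable_entropy.hasSum.add hH.summable_energy.hasSum)).tendsto_sum_nat
  refine ge_of_tendsto hlim ?_
  filter_upwards [eventually_ge_atTop m] with n hn
  have h1 : ∑ i ∈ Finset.range n, ((β (ν i) + ν i * formEnergy V (φ i))
        - (β (nubar i) + nubar i * lam i))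
      = ∑ i ∈ Finset.range n,
          (entropyGap β lam nubar ν i + (ν i - ν (i + 1)) * excess V lam φ (i + 1))
        + ν n * excess V lam φ n := by
    have h2 := sum_range_mul_eq ν (fun j => formEnergy V (φ j) - lam j) n
    change _ = ∑ i ∈ Finset.range n, (ν i - ν (i + 1)) * excess V lam φ (i + 1)
      + ν n * excess V lam φ n at h2
    rw [Finset.sum_add_distrib, add_assoc, ← h2, ← Finset.sum_add_distrib]
    refine Finset.sum_congr rfl fun i _ => ?_
    rw [entropyGap]
    ring
  rw [h1]
  -- The boundary term of the summation by parts is dropped by its sign; it need not tend to zero.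
  have h3 := (hE.mul_excess_nonneg ho he hφ hν hf n).2
  have h4 := Finset.sum_le_sum_of_subset_of_nonneg (Finset.range_mono hn)
    (f := fun i => entropyGap β lam nubar ν i + (ν i - ν (i + 1)) * excess V lam φ (i + 1))
    fun i _ _ => add_nonneg (hH.entropyGap_nonneg hν i) (hE.mul_excess_nonneg ho he hφ hν hf i).1
  linarith

theorem AssumptionH.freeEnergy_eigen (hH : AssumptionH 𝕜 D β V lam nubar)
    (ho : Orthonormal 𝕜 ψ) (he : ∀ i, ψ i ∈ eigenspace 𝕜 V (lam i)) :
    freeEnergy β V nubar ψ = (((∑' i, β (nubar i)) + ∑' i, nubar i * lam i : ℝ) : EReal) := by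
  have h1 : ∀ i, (nubar i : EReal) * energy V (ψ i) = ((nubar i * lam i : ℝ) : EReal) := fun i => by
    rw [(finiteEnergy_of_mem_eigenspace (he i)).energy_eq, formEnergy_eigen (he i), ho.1,
      one_pow, mul_one, EReal.coe_mul]
  rw [freeEnergy]
  simp_rw [h1]
  rw [extendedSum_coe hH.summable_energy, ← EReal.coe_add]

theorem AssumptionH.isMinimizer (hH : AssumptionH 𝕜 D β V lam nubar)
    (ho : Orthonormal 𝕜 ψ) (he : ∀ i, ψ i ∈ eigenspace 𝕜 V (lam i)) :
    IsMinimizer D β V nubar ψ := by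
  refine ⟨hH.nubar_mem_occupationNumbers, ho, fun ν φ hν hφ => ?_⟩
  rcases hH.eigenvalues.freeEnergy_eq_top_or ho he hφ hν with htop | ⟨hf, hs, heq⟩
  · rw [htop]
    exact le_top
  · rw [hH.freeEnergy_eigen ho he, heq, EReal.coe_le_coe_iff]
    have := hH.sum_gap_le ho he hφ hν hf hs 0
    rw [Finset.sum_range_zero] at this
    linarith

/-- A minimizer saturates all inequalities in the comparison with the eigenfunctions. -/
theorem AssumptionH.gap_eq_zero (hH : AssumptionH 𝕜 D β V lam nubar)
    (ho : Orthonormal 𝕜 ψ) (he : ∀ i, ψ i ∈ eigenspace 𝕜 V (lam i))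
    (hmin : IsMinimizer D β V ν φ) :
    (∀ i, 0 < ν i → HasFiniteEnergy V (φ i)) ∧
      ∀ i, entropyGap β lam nubar ν i = 0 ∧ (ν i - ν (i + 1)) * excess V lam φ (i + 1) = 0 := by
  obtain ⟨hν, hφ, hle⟩ := hmin
  have h1 := hle nubar ψ hH.nubar_mem_occupationNumbers ho
  rw [hH.freeEnergy_eigen ho he] at h1
  rcases hH.eigenvalues.freeEnergy_eq_top_or ho he hφ hν with htop | ⟨hf, hs, heq⟩
  · rw [htop, top_le_iff] at h1
    exact absurd h1 (EReal.coe_ne_top _)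
  · rw [heq, EReal.coe_le_coe_iff] at h1
    refine ⟨hf, fun i => ?_⟩
    have hnn : ∀ i, 0 ≤ entropyGap β lam nubar ν i ∧
        0 ≤ (ν i - ν (i + 1)) * excess V lam φ (i + 1) := fun i =>
      ⟨hH.entropyGap_nonneg hν i, (hH.eigenvalues.mul_excess_nonneg ho he hφ hν hf i).1⟩
    have h2 := hH.sum_gap_le ho he hφ hν hf hs (i + 1)
    rw [Finset.sum_range_succ] at h2
    have h3 := Finset.sum_nonneg (s := Finset.range i) fun i _ => add_nonneg (hnn i).1 (hnn i).2
    constructor <;> linarith [(hnn i).1, (hnn i).2]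

theorem AssumptionH.occupation_eq (hH : AssumptionH 𝕜 D β V lam nubar)
    (ho : Orthonormal 𝕜 ψ) (he : ∀ i, ψ i ∈ eigenspace 𝕜 V (lam i))
    (hmin : IsMinimizer D β V ν φ) : ν = nubar := by
  funext i
  by_contra hne
  have h1 := ((hH.gap_eq_zero ho he hmin).2 i).1
  have h2 := hH.lt i (hmin.1.2.1 i).2 hne
  rw [entropyGap] at h1
  linarith

theorem norm_sub_sum_inner_sq {E ι : Type*} [NormedAddCommGroup E] [InnerProductSpace 𝕜 E]
    {v : ι → E} (hv : Orthonormal 𝕜 v) (x : E) (s : Finset ι) :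
    ‖x - ∑ k ∈ s, (inner 𝕜 (v k) x : 𝕜) • v k‖ ^ 2
      = ‖x‖ ^ 2 - ∑ k ∈ s, ‖(inner 𝕜 (v k) x : 𝕜)‖ ^ 2 := by
  have h1 := hv.inner_sum (fun k => (inner 𝕜 (v k) x : 𝕜)) (fun k => (inner 𝕜 (v k) x : 𝕜)) s
  have h2 : (inner 𝕜 x (∑ k ∈ s, (inner 𝕜 (v k) x : 𝕜) • v k) : 𝕜)
      = ((∑ k ∈ s, ‖(inner 𝕜 (v k) x : 𝕜)‖ ^ 2 : ℝ) : 𝕜) := by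
    rw [inner_sum, RCLike.ofReal_sum]
    refine Finset.sum_congr rfl fun k _ => ?_
    rw [inner_smul_right, ← inner_conj_symm x (v k), RCLike.mul_conj, RCLike.ofReal_pow]
  simp only [RCLike.conj_mul, ← RCLike.ofReal_pow, ← RCLike.ofReal_sum] at h1
  rw [norm_sub_sq (𝕜 := 𝕜), h2, ← inner_self_eq_norm_sq (𝕜 := 𝕜) (∑ k ∈ s, _), h1,
    RCLike.ofReal_re]
  ring

/-- At every spectral gap, the first functions of a minimizer span the same space as the first
eigenfunctions. -/
theorem AssumptionH.overlap_minimizer (hH : AssumptionH 𝕜 D β V lam nubar)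
    (hpos : ∀ i, 0 < nubar i) (ho : Orthonormal 𝕜 ψ)
    (he : ∀ i, ψ i ∈ eigenspace 𝕜 V (lam i)) (hmin : IsMinimizer D β V nubar φ) {i : ℕ}
    (hgap : lam i < lam (i + 1)) {k : ℕ} (hk : k ≤ i) :
    overlap ψ φ (Finset.range (i + 1)) k = 1 := by
  obtain ⟨hf, hz⟩ := hH.gap_eq_zero ho he hmin
  -- A spectral gap with positive occupation forces a strict drop of `nubar`, so the weight on the
  -- excess is nonzero and the excess vanishes.
  have hne : nubar i - nubar (i + 1) ≠ 0 := fun h0 =>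
    hgap.ne (hH.lam_eq (hpos i) (sub_eq_zero.mp h0))
  have h1 := (mul_eq_zero.mp (hz i).2).resolve_left hne
  rw [excess, Finset.sum_sub_distrib, sub_eq_zero] at h1
  refine hH.eigenvalues.overlap_eq_one ho he hmin.2.1 (Finset.range (i + 1))
    (fun j _ => hf j (hpos j)) (by rw [Finset.card_range]; exact h1) ?_ ?_
  · rw [Finset.card_range]
    omega
  · rw [Finset.card_range]
    exact lt_of_le_of_lt (hH.eigenvalues.monotone hk) hgap

theorem HasUnboundedEigenvalues.exists_gap (h : HasUnboundedEigenvalues 𝕜 V lam) {k l : ℕ}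
    (hkl : lam k < lam l) : ∃ i, k ≤ i ∧ i < l ∧ lam i < lam (i + 1) := by
  by_contra! hno
  have hlt : k < l := h.monotone.reflect_lt hkl
  have : ∀ n, k + n ≤ l → lam (k + n) ≤ lam k := by
    intro n
    induction n with
    | zero => intro _; rfl
    | succ n ih => exact fun hn => (hno (k + n) (by omega) (by omega)).trans (ih (by omega))
  have := this (l - k) (by omega)
  rw [Nat.add_sub_cancel' hlt.le] at this
  linarith

theorem HasUnboundedEigenvalues.exists_last_eq (h : HasUnboundedEigenvalues 𝕜 V lam) (j : ℕ) :
    ∃ i, j ≤ i ∧ lam i = lam j ∧ lam i < lam (i + 1) := by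
  classical
  have hex : ∃ l, lam j < lam l := (h.tendsto.eventually_gt_atTop (lam j)).exists
  have hjl : j < Nat.find hex := h.monotone.reflect_lt (Nat.find_spec hex)
  obtain ⟨i, hi⟩ : ∃ i, Nat.find hex = i + 1 := ⟨Nat.find hex - 1, by omega⟩
  have hij : lam i = lam j :=
    le_antisymm (not_lt.mp (Nat.find_min hex (by omega))) (h.monotone (by omega))
  exact ⟨i, by omega, hij, by rw [hij, ← hi]; exact Nat.find_spec hex⟩

/-- If all occupation numbers are positive, a minimizer consists of eigenfunctions. -/
theorem AssumptionH.minimizer_mem_eigenspace (hH : AssumptionH 𝕜 D β V lam nubar)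
    (hpos : ∀ i, 0 < nubar i) (ho : Orthonormal 𝕜 ψ)
    (he : ∀ i, ψ i ∈ eigenspace 𝕜 V (lam i)) (hmin : IsMinimizer D β V nubar φ) (j : ℕ) :
    φ j ∈ eigenspace 𝕜 V (lam j) := by
  have hφ := hmin.2.1
  have hE := hH.eigenvalues
  -- `i` is the last index in the cluster of `lam j`, where a gap makes the overlap identity
  -- available.
  obtain ⟨i, hji, hij, hgap⟩ := hE.exists_last_eq j
  have hover := fun k (hk : k ≤ i) => hH.overlap_minimizer hpos ho he hmin hgap hk
  have hbessel : ∀ m, ∑ k ∈ Finset.range (i + 1), ‖(inner 𝕜 (ψ k) (φ m) : 𝕜)‖ ^ 2 ≤ 1 := by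
    intro m
    have := ho.sum_inner_products_le (φ m) (s := Finset.range (i + 1))
    rwa [hφ.1, one_pow] at this
  have hparseval : ∑ k ∈ Finset.range (i + 1), ‖(inner 𝕜 (ψ k) (φ j) : 𝕜)‖ ^ 2 = 1 := by
    -- Double counting: the row sums of the square matrix of squared inner products are `1` and its
    -- column sums are at most `1`, so the latter are all `1`.
    have h1 : ∑ m ∈ Finset.range (i + 1),
        (1 - ∑ k ∈ Finset.range (i + 1), ‖(inner 𝕜 (ψ k) (φ m) : 𝕜)‖ ^ 2) = 0 := by
      rw [Finset.sum_sub_distrib, Finset.sum_comm, sub_eq_zero]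
      exact Finset.sum_congr rfl fun k hk =>
        (hover k (Nat.lt_succ_iff.mp (Finset.mem_range.mp hk))).symm
    have h2 := (Finset.sum_eq_zero_iff_of_nonneg fun m _ => sub_nonneg.mpr (hbessel m)).mp h1 j
      (Finset.mem_range.mpr (Nat.lt_succ_of_le hji))
    linarith
  have hexp : φ j = ∑ k ∈ Finset.range (i + 1), (inner 𝕜 (ψ k) (φ j) : 𝕜) • ψ k := by
    have h1 := norm_sub_sum_inner_sq ho (φ j) (Finset.range (i + 1))
    rw [hparseval, hφ.1, one_pow, sub_self] at h1
    exact sub_eq_zero.mp (norm_eq_zero.mp ((pow_eq_zero_iff two_ne_zero).mp h1))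
  rw [hexp]
  refine Submodule.sum_mem _ fun k hk => ?_
  have hki : k ≤ i := Nat.lt_succ_iff.mp (Finset.mem_range.mp hk)
  rcases (hij ▸ hE.monotone hki : lam k ≤ lam j).lt_or_eq with hlt | heq
  · obtain ⟨p, hkp, hpj, hgp⟩ := hE.exists_gap hlt
    have h1 := hH.overlap_minimizer hpos ho he hmin hgp hkp
    have h2 := overlap_le_one ho hφ (insert j (Finset.range (p + 1))) k
    rw [overlap, Finset.sum_insert (by simp; omega)] at h2
    rw [overlap] at h1
    have h3 : ‖(inner 𝕜 (ψ k) (φ j) : 𝕜)‖ ^ 2 = 0 := le_antisymm (by linarith) (sq_nonneg _)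
    rw [norm_eq_zero.mp ((pow_eq_zero_iff two_ne_zero).mp h3), zero_smul]
    exact Submodule.zero_mem _
  · exact Submodule.smul_mem _ _ (heq ▸ he k)

end Comparison

/-! ### Completeness of the eigenfunctions and unitary equivalence. -/

section Completeness

variable {d : ℕ} {𝕜 : Type} [RCLike 𝕜] {D : Set ℝ} {β : ℝ → ℝ}
  {V : EuclideanSpace ℝ (Fin d) → ℝ} {lam nubar : ℕ → ℝ} {ψ φ : ℕ → L2 d 𝕜} {ν : ℕ → ℝ}

/-- A function orthogonal to all eigenfunctions is orthogonal to all functions of finite energy. -/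
theorem HasUnboundedEigenvalues.inner_eq_zero_of_hasFiniteEnergy
    (h : HasUnboundedEigenvalues 𝕜 V lam) (ho : Orthonormal 𝕜 ψ)
    (he : ∀ i, ψ i ∈ eigenspace 𝕜 V (lam i)) {f g : L2 d 𝕜}
    (hf : ∀ i, (inner 𝕜 f (ψ i) : 𝕜) = 0) (hg : HasFiniteEnergy V g) :
    (inner 𝕜 f g : 𝕜) = 0 := by
  by_contra hne
  set x := ‖(inner 𝕜 f g : 𝕜)‖ ^ 2 with hx
  have hxpos : 0 < x := pow_pos (norm_pos_iff.mpr hne) 2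
  set C := ‖f‖ ^ 2 * (formEnergy V g + |lam 0| * ‖g‖ ^ 2) with hC
  -- `C` does not depend on `n`, so letting `lam n` grow contradicts `x > 0`.
  have key : ∀ n, 0 < lam n → lam n * x ≤ C := by
    intro n hn
    set A := ∑ k ∈ Finset.range n, ‖(inner 𝕜 (ψ k) g : 𝕜)‖ ^ 2 with hA
    have h1 := h.spectral_bound ho he n hg
    rw [← hA] at h1
    have hA0 : 0 ≤ A := Finset.sum_nonneg fun _ _ => sq_nonneg _
    have hA1 : A ≤ ‖g‖ ^ 2 := ho.sum_inner_products_le g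
    have h2 : -(|lam 0| * ‖g‖ ^ 2)
        ≤ ∑ k ∈ Finset.range n, lam k * ‖(inner 𝕜 (ψ k) g : 𝕜)‖ ^ 2 := by
      calc -(|lam 0| * ‖g‖ ^ 2) ≤ -(|lam 0| * A) :=
            neg_le_neg (mul_le_mul_of_nonneg_left hA1 (abs_nonneg _))
        _ ≤ lam 0 * A := by nlinarith [neg_abs_le (lam 0)]
        _ ≤ _ := by
          rw [hA, Finset.mul_sum]
          exact Finset.sum_le_sum fun k _ =>
            mul_le_mul_of_nonneg_right (h.monotone (Nat.zero_le k)) (sq_nonneg _)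
    have h3 : x ≤ ‖f‖ ^ 2 * (‖g‖ ^ 2 - A) := by
      -- Subtracting the projection of `g` is invisible to `f`, and the energy of `g` controls the
      -- norm of the remainder.
      have h4 : (inner 𝕜 f g : 𝕜)
          = inner 𝕜 f (g - ∑ k ∈ Finset.range n, (inner 𝕜 (ψ k) g : 𝕜) • ψ k) := by
        simp [inner_sub_right, inner_sum, inner_smul_right, hf]
      rw [hx, h4, hA, ← norm_sub_sum_inner_sq ho, ← mul_pow]
      exact pow_le_pow_left₀ (norm_nonneg _) (norm_inner_le_norm _ _) 2
    calc lam n * x ≤ lam n * (‖f‖ ^ 2 * (‖g‖ ^ 2 - A)) := mul_le_mul_of_nonneg_left h3 hn.le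
      _ = ‖f‖ ^ 2 * (lam n * (‖g‖ ^ 2 - A)) := by ring
      _ ≤ C := mul_le_mul_of_nonneg_left (by linarith) (sq_nonneg _)
  obtain ⟨n, hn0, hn⟩ := ((h.tendsto.eventually_gt_atTop 0).and
    (h.tendsto.eventually_gt_atTop (C / x))).exists
  rw [div_lt_iff₀ hxpos] at hn
  linarith [key n hn0]

theorem memLp_ofReal_of_hasCompactSupport {g : EuclideanSpace ℝ (Fin d) → ℝ} (hg : Continuous g)
    (hc : HasCompactSupport g) : MemLp (fun x => (g x : 𝕜)) 2 :=
  (hg.memLp_of_hasCompactSupport hc).ofReal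

/-- Real valued test functions have finite energy. -/
theorem hasFiniteEnergy_toLp (hV : LocallyIntegrable V) {g : EuclideanSpace ℝ (Fin d) → ℝ}
    (hg : ContDiff ℝ ∞ g) (hc : HasCompactSupport g) :
    HasFiniteEnergy V ((memLp_ofReal_of_hasCompactSupport (𝕜 := 𝕜) hg.continuous hc).toLp _) := by
  have hfd : ∀ {f : EuclideanSpace ℝ (Fin d) → ℝ}, ContDiff ℝ ∞ f → ∀ v,
      Continuous fun x => fderiv ℝ f x v := fun hf v =>
    (hf.continuous_fderiv (by simp)).clm_apply continuous_const
  constructor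
  · intro j
    have hcj : HasCompactSupport fun x => fderiv ℝ g x (EuclideanSpace.single j 1) :=
      hc.fderiv_apply (𝕜 := ℝ) _
    refine ⟨(memLp_ofReal_of_hasCompactSupport (𝕜 := 𝕜) (hfd hg _) hcj).toLp _, ?_⟩
    intro f hf hfc
    have hfcj : HasCompactSupport fun x => fderiv ℝ f x (EuclideanSpace.single j 1) :=
      hfc.fderiv_apply (𝕜 := ℝ) _
    have e : ∀ (a b : EuclideanSpace ℝ (Fin d) → ℝ) (hb : MemLp (fun x => (b x : 𝕜)) 2),
        ∫ x, a x • (hb.toLp _ : L2 d 𝕜) x = ((∫ x, a x * b x : ℝ) : 𝕜) := by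
      intro a b hb
      rw [← integral_ofReal]
      apply integral_congr_ae
      filter_upwards [hb.coeFn_toLp] with x hx
      rw [hx, RCLike.real_smul_eq_coe_mul, RCLike.ofReal_mul]
    rw [e, e, ← RCLike.ofReal_neg, integral_mul_fderiv_eq_neg_fderiv_mul_of_integrable, neg_neg]
    · exact ((hfd hf _).mul hg.continuous).integrable_of_hasCompactSupport hfcj.mul_right
    · exact (hf.continuous.mul (hfd hg _)).integrable_of_hasCompactSupport hfc.mul_right
    · exact (hf.continuous.mul hg.continuous).integrable_of_hasCompactSupport hfc.mul_right
    · exact fun x _ => (hf.differentiable (by simp)).differentiableAt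
    · exact fun x _ => (hg.differentiable (by simp)).differentiableAt
  · have h1 : Integrable fun x => g x ^ 2 • V x := by
      refine hV.integrable_smul_left_of_hasCompactSupport (hg.continuous.pow 2) ?_
      exact hc.comp_left (g := fun t => t ^ 2) (by simp)
    refine h1.congr ?_
    filter_upwards [(memLp_ofReal_of_hasCompactSupport (𝕜 := 𝕜) hg.continuous hc).coeFn_toLp]
      with x hx
    rw [hx, RCLike.norm_ofReal, sq_abs, smul_eq_mul, mul_comm]

/-- The eigenfunctions form a complete orthonormal system. -/
theorem HasUnboundedEigenvalues.eq_zero_of_inner (h : HasUnboundedEigenvalues 𝕜 V lam)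
    (hV : LocallyIntegrable V) (ho : Orthonormal 𝕜 ψ)
    (he : ∀ i, ψ i ∈ eigenspace 𝕜 V (lam i)) {f : L2 d 𝕜}
    (hf : ∀ i, (inner 𝕜 (ψ i) f : 𝕜) = 0) : f = 0 := by
  rw [Lp.eq_zero_iff_ae_eq_zero]
  refine ae_eq_zero_of_integral_contDiff_smul_eq_zero
    ((Lp.memLp f).locallyIntegrable (by norm_num)) fun g hg hc => ?_
  have h1 := h.inner_eq_zero_of_hasFiniteEnergy ho he
    (fun i => inner_eq_zero_symm.mp (hf i)) (hasFiniteEnergy_toLp (𝕜 := 𝕜) hV hg hc)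
  rw [inner_eq_zero_symm, L2.inner_def] at h1
  rw [← h1]
  apply integral_congr_ae
  filter_upwards [(memLp_ofReal_of_hasCompactSupport (𝕜 := 𝕜) hg.continuous hc).coeFn_toLp]
    with x hx
  rw [hx, RCLike.inner_apply, RCLike.conj_ofReal, RCLike.real_smul_eq_coe_mul, mul_comm]

theorem HasUnboundedEigenvalues.orthogonal_span_eq_bot (h : HasUnboundedEigenvalues 𝕜 V lam)
    (hV : LocallyIntegrable V) (ho : Orthonormal 𝕜 ψ)
    (he : ∀ i, ψ i ∈ eigenspace 𝕜 V (lam i)) : (Submodule.span 𝕜 (Set.range ψ))ᗮ = ⊥ := by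
  refine (Submodule.eq_bot_iff _).mpr fun f hf => ?_
  exact h.eq_zero_of_inner hV ho he fun i =>
    (Submodule.mem_orthogonal _ _).mp hf _ (Submodule.subset_span ⟨i, rfl⟩)

/-- An eigenfunction minus its components in the finite fiber over `μ` is orthogonal to every `ψ i`,
hence zero. For an empty fiber this rules out further eigenvalues. -/
theorem HasUnboundedEigenvalues.eigenspace_eq_span (h : HasUnboundedEigenvalues 𝕜 V lam)
    (hV : LocallyIntegrable V) (ho : Orthonormal 𝕜 ψ)
    (he : ∀ i, ψ i ∈ eigenspace 𝕜 V (lam i)) (μ : ℝ) :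
    eigenspace 𝕜 V μ = Submodule.span 𝕜 (ψ '' {i | lam i = μ}) := by
  refine le_antisymm (fun f hf => ?_) (Submodule.span_le.mpr ?_)
  · have hfin : {i | lam i = μ}.Finite := Set.finite_coe_iff.mp (h.finite_fiber μ)
    have hz : f - ∑ k ∈ hfin.toFinset, (inner 𝕜 (ψ k) f : 𝕜) • ψ k = 0 := by
      refine h.eq_zero_of_inner hV ho he fun i => ?_
      rw [inner_sub_right]
      by_cases hi : lam i = μ
      · rw [ho.inner_right_sum _ (hfin.mem_toFinset.mpr hi), sub_self]
      · rw [inner_eq_zero_of_eigenspace_ne hi (he i) hf, inner_sum, zero_sub, neg_eq_zero]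
        refine Finset.sum_eq_zero fun k hk => ?_
        have hk' : lam k = μ := hfin.mem_toFinset.mp hk
        rw [inner_smul_right, ho.2 (show i ≠ k by rintro rfl; exact hi hk'), mul_zero]
    rw [sub_eq_zero.mp hz]
    exact Submodule.sum_mem _ fun k hk => Submodule.smul_mem _ _
      (Submodule.subset_span ⟨k, hfin.mem_toFinset.mp hk, rfl⟩)
  · rintro _ ⟨i, rfl, rfl⟩
    exact he i

/-- Two orthonormal systems of eigenfunctions are related by a unitary map that leaves all
eigenspaces invariant. -/
theorem HasUnboundedEigenvalues.exists_unitary (h : HasUnboundedEigenvalues 𝕜 V lam)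
    (hV : LocallyIntegrable V) (ho : Orthonormal 𝕜 ψ)
    (he : ∀ i, ψ i ∈ eigenspace 𝕜 V (lam i)) (ho' : Orthonormal 𝕜 φ)
    (he' : ∀ i, φ i ∈ eigenspace 𝕜 V (lam i)) :
    ∃ U : L2 d 𝕜 ≃ₗᵢ[𝕜] L2 d 𝕜, PreservesEigenspaces V U ∧ ∀ i, φ i = U (ψ i) := by
  let b := HilbertBasis.mkOfOrthogonalEqBot ho (h.orthogonal_span_eq_bot hV ho he)
  let b' := HilbertBasis.mkOfOrthogonalEqBot ho' (h.orthogonal_span_eq_bot hV ho' he')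
  have hb : ∀ i, b i = ψ i := fun i =>
    congrFun (HilbertBasis.coe_mkOfOrthogonalEqBot ho (h.orthogonal_span_eq_bot hV ho he)) i
  have hb' : ∀ i, b' i = φ i := fun i =>
    congrFun (HilbertBasis.coe_mkOfOrthogonalEqBot ho' (h.orthogonal_span_eq_bot hV ho' he')) i
  have hU : ∀ i, (b.repr.trans b'.repr.symm) (ψ i) = φ i := fun i => by
    classical
    rw [LinearIsometryEquiv.trans_apply, ← hb, b.repr_self, b'.repr_symm_single, hb']
  refine ⟨b.repr.trans b'.repr.symm, fun μ => ?_, fun i => (hU i).symm⟩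
  conv_lhs => rw [h.eigenspace_eq_span hV ho he μ]
  rw [h.eigenspace_eq_span hV ho' he' μ, Submodule.map_span, ← Set.image_comp]
  congr 1
  exact Set.image_congr fun i _ => hU i

/-- Phases preserve orthonormality and each energy, even an infinite one, so the competitors and the
value are unchanged. -/
theorem IsMinimizer.smul (h : IsMinimizer D β V ν φ) {c : ℕ → 𝕜} (hc : ∀ i, ‖c i‖ = 1) :
    IsMinimizer D β V ν fun i => c i • φ i := by
  obtain ⟨hν, hφ, hle⟩ := h
  refine ⟨hν, ⟨fun i => by rw [norm_smul, hc, hφ.1, one_mul], fun i j hij => ?_⟩, ?_⟩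
  · change (inner 𝕜 (c i • φ i) (c j • φ j) : 𝕜) = 0
    rw [inner_smul_left, inner_smul_right, hφ.2 hij, mul_zero, mul_zero]
  · have : freeEnergy β V ν (fun i => c i • φ i) = freeEnergy β V ν φ := by
      rw [freeEnergy, freeEnergy]
      simp_rw [energy_smul_of_norm_one (hc _)]
    rwa [this]

end Completeness

end FreeEnergy

theorem mainTheorem10 {d : ℕ} (𝕜 : Type) [RCLike 𝕜] (D : Set ℝ) (β : ℝ → ℝ)
    (V : EuclideanSpace ℝ (Fin d) → ℝ) (lam nubar : ℕ → ℝ)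
    (hH : FreeEnergy.AssumptionH 𝕜 D β V lam nubar) :
    -- there are orthonormal eigenfunctions for the `lam i`, which can be chosen real valued
    (∃ ψ : ℕ → FreeEnergy.L2 d 𝕜, Orthonormal 𝕜 ψ ∧
      (∀ i, ψ i ∈ FreeEnergy.eigenspace 𝕜 V (lam i)) ∧
      ∀ i, ∀ᵐ x, RCLike.im (ψ i x) = 0) ∧
    -- every such choice, together with `nubar`, is a minimizer, with finite free energy
    (∀ ψ : ℕ → FreeEnergy.L2 d 𝕜, Orthonormal 𝕜 ψ →
      (∀ i, ψ i ∈ FreeEnergy.eigenspace 𝕜 V (lam i)) →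
      FreeEnergy.IsMinimizer D β V nubar ψ ∧
      Summable (fun i => |β (nubar i)|) ∧ Summable (fun i => |nubar i * lam i|) ∧
      FreeEnergy.freeEnergy β V nubar ψ =
        (((∑' i, β (nubar i)) + ∑' i, nubar i * lam i : ℝ) : EReal)) ∧
    -- the occupation numbers of any minimizer are `nubar`
    (∀ (ν : ℕ → ℝ) (ψ : ℕ → FreeEnergy.L2 d 𝕜),
      FreeEnergy.IsMinimizer D β V ν ψ → ν = nubar) ∧
    -- if they are positive, the functions are eigenfunctions, unique up to unitary maps
    -- that leave all eigenspaces invariant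
    ((∀ i, 0 < nubar i) →
      (∀ ψ : ℕ → FreeEnergy.L2 d 𝕜, FreeEnergy.IsMinimizer D β V nubar ψ →
        ∀ i, ψ i ∈ FreeEnergy.eigenspace 𝕜 V (lam i)) ∧
      ∀ ψ : ℕ → FreeEnergy.L2 d 𝕜, FreeEnergy.IsMinimizer D β V nubar ψ →
        ∀ ψ' : ℕ → FreeEnergy.L2 d 𝕜, FreeEnergy.IsMinimizer D β V nubar ψ' ↔
          ∃ U : FreeEnergy.L2 d 𝕜 ≃ₗᵢ[𝕜] FreeEnergy.L2 d 𝕜,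
            FreeEnergy.PreservesEigenspaces V U ∧ ∀ i, ψ' i = U (ψ i)) ∧
    -- in particular each function may be multiplied by a constant phase
    (∀ (ν : ℕ → ℝ) (ψ : ℕ → FreeEnergy.L2 d 𝕜) (c : ℕ → 𝕜), (∀ i, ‖c i‖ = 1) →
      FreeEnergy.IsMinimizer D β V ν ψ → FreeEnergy.IsMinimizer D β V ν (fun i => c i • ψ i)) := by
  have hE := hH.eigenvalues
  have hV := hH.locallyIntegrable
  obtain ⟨χ, hχo, hχe, -⟩ := hE.exists_real_eigenfunctions
  have heig := fun (hpos : ∀ i, 0 < nubar i) (ψ : ℕ → FreeEnergy.L2 d 𝕜)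
    (hψ : FreeEnergy.IsMinimizer D β V nubar ψ) =>
      hH.minimizer_mem_eigenspace hpos hχo hχe hψ
  refine ⟨hE.exists_real_eigenfunctions, fun ψ ho he => ⟨hH.isMinimizer ho he,
    hH.summable_entropy.abs, hH.summable_energy.abs, hH.freeEnergy_eigen ho he⟩,
    fun ν ψ hmin => hH.occupation_eq hχo hχe hmin, fun hpos => ⟨heig hpos, fun ψ hψ ψ' => ?_⟩,
    fun ν ψ c hc hmin => hmin.smul hc⟩
  constructor
  · intro hψ'
    exact hE.exists_unitary hV hψ.2.1 (heig hpos ψ hψ) hψ'.2.1 (heig hpos ψ' hψ')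
  · rintro ⟨U, hU, hψ'⟩
    obtain rfl : ψ' = fun i => U (ψ i) := funext hψ'
    -- The converse reduces to existence: `U` sends eigenfunctions to eigenfunctions of the same
    -- eigenvalue, and any such orthonormal system minimizes.
    refine hH.isMinimizer (hψ.2.1.comp_linearIsometry U.toLinearIsometry) fun i => ?_
    rw [← hU (lam i)]
    exact Submodule.mem_map_of_mem (heig hpos ψ hψ i)
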